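/- Let $\mathbf{PP}$ be the PRO (strict monoidal category with objects the natural numbers, $\oplus$ on objects being addition) freely generated by phase shifters $P(\varphi)\colon 1\to1$ and beam splitters $B(\theta)\colon 2\to2$, for $\varphi,\theta\in\mathbb R$. Its morphisms are the polarisation-preserving circuits; in $f\oplus g$, $f$ is placed above $g$. Write $f;g$ for "$f$ followed by $g$", and $I$ for one wire. Let $[\![C]\!]$ be the matrix of $C$ given by $[\![P(\varphi)]\!]=(e^{i\varphi})$, $[\![B(\theta)]\!]=\begin{pmatrix}\cos\theta&i\sin\theta\\ i\sin\theta&\cos\theta\end{pmatrix}$, $[\![f;g]\!]=[\![g]\!][\![f]\!]$, $[\![f\oplus g]\!]=[\![f]\!]\oplus[\![g]\!]$ (block diagonal). $P^\star(\varphi)$ denotes either $P(\varphi)$ or $I$. The rewrite system PPRS on circuits is obtained by closing the following rules under composition and $\oplus$, where $\psi\in\mathbb R\setminus[0,2\pi)$, $\varphi,\varphi_1,\varphi_2\in(0,2\pi)$, $\varphi_0,\theta_4\in[\pi,2\pi)$, $\theta,\theta_0,\theta_1,\theta_2,\theta_3\in(0,\pi)$, $\theta_0\ne\frac\pi2$: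 1. $P(\psi)\to P(\psi \bmod 2\pi)$; 2. $B(\psi)\to B(\psi\bmod 2\pi)$; 3. $P(\varphi_1);P(\varphi_2)\to P(\varphi_1+\varphi_2)$; 4. $P(0)\to I$; 5. $B(0)\to I\oplus I$; 6. $(I\oplus P(\varphi));B(\theta)\to (P(-\varphi)\oplus I);B(\theta);(P(\varphi)\oplus P(\varphi))$; 7. $(P(\varphi)\oplus I);B(\frac\pi2)\to B(\frac\pi2);(I\oplus P(\varphi))$; 8. $(P(\varphi_0)\oplus I);B(\theta_0)\to (P(\varphi_0-\pi)\oplus I);B(\pi-\theta_0);(I\oplus P(\pi))$; 9. $B(\theta_4)\to B(\theta_4-\pi);(P(\pi)\oplus P(\pi))$; 10. $(B(\theta_1)\oplus I);(P^\star(\varphi_2)\oplus P^\star(\varphi_1)\oplus I);(I\oplus B(\theta_2));(B(\theta_3)\oplus I)\to T_3$, where $T_3$ is the circuit $$(I\oplus P(\beta_1)\oplus I);(I\oplus B(\alpha_1));(P(\beta_2)\oplus I\oplus I);(B(\alpha_2)\oplus I);(I\oplus P(\beta_3)\oplus I);(I\oplus B(\alpha_3));(P(\beta_4)\oplus P(\beta_5)\oplus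 P(\beta_6))$$ having the same matrix $[\![\cdot]\!]$ as the left-hand side, with $\alpha_1,\alpha_2,\alpha_3,\beta_1,\beta_2,\beta_3\in[0,\pi)$, $\beta_4,\beta_5,\beta_6\in[0,2\pi)$, $\alpha_i\in\{0,\frac\pi2\}\Rightarrow\beta_i=0$ for $i=1,2,3$, and $\alpha_2=0\Rightarrow\alpha_1=0$; 11. $B(\theta_1);(P^\star(\varphi_1)\oplus I);B(\theta_2)\to T_2$, where $T_2$ is the circuit $(P(\beta_1)\oplus I);B(\alpha_1);(P(\beta_2)\oplus P(\beta_3))$ having the same matrix as the left-hand side, with $\alpha_1,\beta_1\in[0,\pi)$, $\beta_2,\beta_3\in[0,2\pi)$ and $\alpha_1\in\{0,\frac\pi2\}\Rightarrow\beta_1=0$. **Theorem.** For every $n$, PPRS is globally confluent on circuits with $n$ wires: whenever a circuit $C$ rewrites, in any number of steps, to $D_1$ and to $D_2$, there is a circuit $D_3$ to which both $D_1$ and $D_2$ rewrite, in any number of steps (zero allowed). The same holds for the variant of PPRS in which the angles $\theta_i,\varphi_i$ on the left-hand sides of rules 10 and 11 may be arbitrary real numbers. -/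

import Mathlib

namespace LOpp

/-- Raw terms for polarisation-preserving linear optical circuits `n → n`, built from phase shifters
and beam splitters.  `comp f g` is the circuit `f` followed by `g` (horizontal composition, read
from left to right, i.e. `g ∘ f`), and `tensor f g` is `f` placed above `g` (`f ⊕ g`).
Wires are numbered from the top, starting with `0`. -/
inductive Term : ℕ → Type
  | id (n : ℕ) : Term n
  | ps (φ : ℝ) : Term 1
  | bs (θ : ℝ) : Term 2
  | comp {n : ℕ} (f g : Term n) : Term n
  | tensor {n m : ℕ} (f : Term n) (g : Term m) : Term (n + m)

namespace Term

/-- Transport of a term along an equality of sizes. -/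
def cast {n m : ℕ} (h : n = m) (f : Term n) : Term m := h ▸ f

/-- The axioms of PROs (strict monoidal categories whose objects are the natural numbers):
the smallest congruence on terms which contains them. -/
inductive ProEq : ∀ {n : ℕ}, Term n → Term n → Prop
  | refl {n : ℕ} (f : Term n) : ProEq f f
  | symm {n : ℕ} {f g : Term n} : ProEq f g → ProEq g f
  | trans {n : ℕ} {f g h : Term n} : ProEq f g → ProEq g h → ProEq f h
  | comp_congr {n : ℕ} {f f' g g' : Term n} :
      ProEq f f' → ProEq g g' → ProEq (comp f g) (comp f' g')
  | tensor_congr {n m : ℕ} {f f' : Term n} {g g' : Term m} :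
      ProEq f f' → ProEq g g' → ProEq (tensor f g) (tensor f' g')
  | id_comp {n : ℕ} (f : Term n) : ProEq (comp (id n) f) f
  | comp_id {n : ℕ} (f : Term n) : ProEq (comp f (id n)) f
  | comp_assoc {n : ℕ} (f g h : Term n) :
      ProEq (comp (comp f g) h) (comp f (comp g h))
  | tensor_id (n m : ℕ) : ProEq (tensor (id n) (id m)) (id (n + m))
  | interchange {n m : ℕ} (f f' : Term n) (g g' : Term m) :
      ProEq (tensor (comp f f') (comp g g')) (comp (tensor f g) (tensor f' g'))
  | empty_tensor {n : ℕ} (f : Term n) : ProEq ((tensor (id 0) f).cast (Nat.zero_add n)) f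
  | tensor_empty {n : ℕ} (f : Term n) : ProEq (tensor f (id 0)) f
  | tensor_assoc {n m k : ℕ} (f : Term n) (g : Term m) (h : Term k) :
      ProEq ((tensor (tensor f g) h).cast (Nat.add_assoc n m k)) (tensor f (tensor g h))

/-- The single-photon semantics of a circuit, for a fixed polarisation, as a matrix acting on
column vectors indexed by the wires. -/
noncomputable def sem : ∀ {n : ℕ}, Term n → Matrix (Fin n) (Fin n) ℂ
  | _, id _ => 1
  | _, ps φ => !![Complex.exp (φ * Complex.I)]
  | _, bs θ => !![(Real.cos θ : ℂ), Complex.I * (Real.sin θ : ℂ);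
                  Complex.I * (Real.sin θ : ℂ), (Real.cos θ : ℂ)]
  | _, comp f g => sem g * sem f
  | _, tensor f g => (Matrix.fromBlocks (sem f) 0 0 (sem g)).submatrix
      finSumFinEquiv.symm finSumFinEquiv.symm

/-- `comp` of three terms and more, read from left to right. -/
def seq {n : ℕ} : List (Term n) → Term n
  | [] => id n
  | [f] => f
  | f :: l => comp f (seq l)

/-- A "starred" phase shifter: either a phase shifter or an identity wire. -/
def psStar : Option ℝ → Term 1
  | none => id 1
  | some φ => ps φ

/-- On two wires: `f` on the top wire and `g` on the bottom wire. -/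
def par (f g : Term 1) : Term 2 := tensor f g

/-- On three wires: a two-wire circuit on the top two wires. -/
def top (f : Term 2) : Term 3 := tensor f (id 1)

/-- On three wires: a two-wire circuit on the bottom two wires. -/
def bot (f : Term 2) : Term 3 := tensor (id 1) f

/-- On three wires: `f`, `g`, `h` on the wires `0`, `1`, `2`. -/
def par3 (f g h : Term 1) : Term 3 := tensor f (tensor g h)

/-- The two-mode triangular shape: a phase shifter `β₁` on the top wire, a beam splitter `α₁`, and
phase shifters `β₂` (top) and `β₃` (bottom). -/
def tri2 (α₁ β₁ β₂ β₃ : ℝ) : Term 2 :=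
  seq [par (ps β₁) (id 1), bs α₁, par (ps β₂) (ps β₃)]

/-- The three-mode triangular shape: beam splitters `α₁`, `α₂`, `α₃` successively on the bottom two,
top two and bottom two wires, each with a phase shifter `βᵢ` on its top left,
and then phase shifters `β₄`, `β₅`, `β₆` on the three wires. -/
def tri3 (α₁ α₂ α₃ β₁ β₂ β₃ β₄ β₅ β₆ : ℝ) : Term 3 :=
  seq [bot (par (ps β₁) (id 1)), bot (bs α₁),
       top (par (ps β₂) (id 1)), top (bs α₂),
       bot (par (ps β₃) (id 1)), bot (bs α₃),
       par3 (ps β₄) (ps β₅) (ps β₆)]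

open Set Real in
/-- The conditions under which the angles of the two-mode triangular shape are unique. -/
def Canonical2 (α₁ β₁ β₂ β₃ : ℝ) : Prop :=
  α₁ ∈ Ico 0 π ∧ β₁ ∈ Ico 0 π ∧ β₂ ∈ Ico 0 (2 * π) ∧ β₃ ∈ Ico 0 (2 * π) ∧
  (α₁ = 0 ∨ α₁ = π / 2 → β₁ = 0)

open Set Real in
/-- The conditions under which the angles of the three-mode triangular shape are unique. -/
def Canonical3 (α₁ α₂ α₃ β₁ β₂ β₃ β₄ β₅ β₆ : ℝ) : Prop :=
  α₁ ∈ Ico 0 π ∧ α₂ ∈ Ico 0 π ∧ α₃ ∈ Ico 0 π ∧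
  β₁ ∈ Ico 0 π ∧ β₂ ∈ Ico 0 π ∧ β₃ ∈ Ico 0 π ∧
  β₄ ∈ Ico 0 (2 * π) ∧ β₅ ∈ Ico 0 (2 * π) ∧ β₆ ∈ Ico 0 (2 * π) ∧
  (α₁ = 0 ∨ α₁ = π / 2 → β₁ = 0) ∧
  (α₂ = 0 ∨ α₂ = π / 2 → β₂ = 0) ∧
  (α₃ = 0 ∨ α₃ = π / 2 → β₃ = 0) ∧
  (α₂ = 0 → α₁ = 0)

end Term

open Term Set Real in
/-- The rewriting rules.  The sets `Θ` and `Φ` are the ranges of the angles of the beam splitters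
and of the phase shifters in the left-hand sides of the two Euler rules `euler3` and `euler2`;
the right-hand side of an Euler rule is the triangular shape with canonical angles
which has the same semantics as the left-hand side. -/
inductive Rule (Θ Φ : Set ℝ) : ∀ {n : ℕ}, Term n → Term n → Prop
  | ps_mod (ψ : ℝ) : ψ ∉ Ico 0 (2 * π) →
      Rule Θ Φ (ps ψ) (ps (toIcoMod two_pi_pos 0 ψ))
  | bs_mod (ψ : ℝ) : ψ ∉ Ico 0 (2 * π) →
      Rule Θ Φ (bs ψ) (bs (toIcoMod two_pi_pos 0 ψ))
  | ps_fusion (φ₁ φ₂ : ℝ) : φ₁ ∈ Ioo 0 (2 * π) → φ₂ ∈ Ioo 0 (2 * π) →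
      Rule Θ Φ (comp (ps φ₁) (ps φ₂)) (ps (φ₁ + φ₂))
  | ps_zero : Rule Θ Φ (ps 0) (id 1)
  | bs_zero : Rule Θ Φ (bs 0) (id 2)
  | bottom_phase (φ θ : ℝ) : φ ∈ Ioo 0 (2 * π) → θ ∈ Ioo 0 π →
      Rule Θ Φ (comp (par (id 1) (ps φ)) (bs θ))
        (seq [par (ps (-φ)) (id 1), bs θ, par (ps φ) (ps φ)])
  | pi_div_two (φ : ℝ) : φ ∈ Ioo 0 (2 * π) →
      Rule Θ Φ (comp (par (ps φ) (id 1)) (bs (π / 2)))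
        (comp (bs (π / 2)) (par (id 1) (ps φ)))
  | top_phase (φ₀ θ₀ : ℝ) : φ₀ ∈ Ico π (2 * π) → θ₀ ∈ Ioo 0 π → θ₀ ≠ π / 2 →
      Rule Θ Φ (comp (par (ps φ₀) (id 1)) (bs θ₀))
        (seq [par (ps (φ₀ - π)) (id 1), bs (π - θ₀), par (id 1) (ps π)])
  | bs_sub_pi (θ₄ : ℝ) : θ₄ ∈ Ico π (2 * π) →
      Rule Θ Φ (bs θ₄) (comp (bs (θ₄ - π)) (par (ps π) (ps π)))
  | euler3 (θ₁ θ₂ θ₃ : ℝ) (φ₁ φ₂ : Option ℝ) (α₁ α₂ α₃ β₁ β₂ β₃ β₄ β₅ β₆ : ℝ) :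
      θ₁ ∈ Θ → θ₂ ∈ Θ → θ₃ ∈ Θ → (∀ φ ∈ φ₁, φ ∈ Φ) → (∀ φ ∈ φ₂, φ ∈ Φ) →
      Canonical3 α₁ α₂ α₃ β₁ β₂ β₃ β₄ β₅ β₆ →
      sem (tri3 α₁ α₂ α₃ β₁ β₂ β₃ β₄ β₅ β₆) =
        sem (seq [top (bs θ₁), par3 (psStar φ₂) (psStar φ₁) (id 1), bot (bs θ₂), top (bs θ₃)]) →
      Rule Θ Φ
        (seq [top (bs θ₁), par3 (psStar φ₂) (psStar φ₁) (id 1), bot (bs θ₂), top (bs θ₃)])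
        (tri3 α₁ α₂ α₃ β₁ β₂ β₃ β₄ β₅ β₆)
  | euler2 (θ₁ θ₂ : ℝ) (φ₁ : Option ℝ) (α₁ β₁ β₂ β₃ : ℝ) :
      θ₁ ∈ Θ → θ₂ ∈ Θ → (∀ φ ∈ φ₁, φ ∈ Φ) →
      Canonical2 α₁ β₁ β₂ β₃ →
      sem (tri2 α₁ β₁ β₂ β₃) = sem (seq [bs θ₁, par (psStar φ₁) (id 1), bs θ₂]) →
      Rule Θ Φ (seq [bs θ₁, par (psStar φ₁) (id 1), bs θ₂]) (tri2 α₁ β₁ β₂ β₃)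

/-- Equality of terms up to the axioms of PROs (that is, up to deformation). -/
instance termSetoid (n : ℕ) : Setoid (Term n) where
  r := Term.ProEq
  iseqv := ⟨Term.ProEq.refl, Term.ProEq.symm, Term.ProEq.trans⟩

/-- The polarisation-preserving circuits on `n` wires: the morphisms `n → n` of the PRO generated by
phase shifters and beam splitters.  As every generator has as many inputs as outputs,
there are no morphisms `n → m` with `n ≠ m`. -/
def Circuit (n : ℕ) : Type := Quotient (termSetoid n)

namespace Circuit

/-- The circuit which a term denotes. -/
def mk {n : ℕ} (f : Term n) : Circuit n := Quotient.mk (termSetoid n) f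

/-- Sequential composition, `C` followed by `D`. -/
def comp {n : ℕ} (C D : Circuit n) : Circuit n :=
  Quotient.map₂ Term.comp (fun _ _ h _ _ h' => Term.ProEq.comp_congr h h') C D

/-- Parallel composition, `C` above `D`. -/
def tensor {n m : ℕ} (C : Circuit n) (D : Circuit m) : Circuit (n + m) :=
  Quotient.map₂ Term.tensor (fun _ _ h _ _ h' => Term.ProEq.tensor_congr h h') C D

end Circuit

/-- One rewriting step on circuits: a rule is applied to a sub-circuit. -/
inductive Step (Θ Φ : Set ℝ) : ∀ {n : ℕ}, Circuit n → Circuit n → Prop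
  | rule {n : ℕ} {l r : Term n} : Rule Θ Φ l r → Step Θ Φ (Circuit.mk l) (Circuit.mk r)
  | comp_left {n : ℕ} {C C' : Circuit n} (D : Circuit n) :
      Step Θ Φ C C' → Step Θ Φ (C.comp D) (C'.comp D)
  | comp_right {n : ℕ} (C : Circuit n) {D D' : Circuit n} :
      Step Θ Φ D D' → Step Θ Φ (C.comp D) (C.comp D')
  | tensor_left {n m : ℕ} {C C' : Circuit n} (D : Circuit m) :
      Step Θ Φ C C' → Step Θ Φ (C.tensor D) (C'.tensor D)
  | tensor_right {n m : ℕ} (C : Circuit n) {D D' : Circuit m} :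
      Step Θ Φ D D' → Step Θ Φ (C.tensor D) (C.tensor D')

/-- PPRS on circuits with `n` wires. -/
def PPRS (n : ℕ) : Circuit n → Circuit n → Prop :=
  Step (Set.Ioo 0 Real.pi) (Set.Ioo 0 (2 * Real.pi))

/-- The variant of PPRS in which the angles in the left-hand sides of the two Euler rules are
arbitrary real numbers. -/
def PPRSAnyAngle (n : ℕ) : Circuit n → Circuit n → Prop :=
  Step Set.univ Set.univ

/-- Global confluence: if `a` rewrites in any number of steps to `b` and to `c`, then `b` and `c`
rewrite in some numbers of steps to a common `d`. -/
def GloballyConfluent {α : Type*} (r : α → α → Prop) : Prop :=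
  ∀ a b c : α, Relation.ReflTransGen r a b → Relation.ReflTransGen r a c →
    ∃ d : α, Relation.ReflTransGen r b d ∧ Relation.ReflTransGen r c d

end LOpp

/-! Confluence is obtained without termination or critical pairs, from three facts. Every rule
preserves the matrix (`sem_eq_of_rule`, `Step.csem_eq`). Every circuit rewrites, already in PPRS, to
some normal form (`exists_isNF`). Normal forms with equal matrices are equal (`IsNF.eq_of_csem_eq`).
Two reducts of one circuit have the same matrix, hence rewrite to the same normal form. The variant
has all the steps of PPRS and its rules are sound too, so the same argument covers it.

A normal form mirrors the elimination of a unitary matrix row by row: for each wire `k`, a run of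
beam splitters climbing to the wires `k`, `k + 1`, then a phase on wire `k`, then a normal form on
the wires below. Row `k` of its matrix involves only the run and the phase. The last cell of the run
puts `cos α · exp(iβ)` at entry `k` and scales the row of the shorter run by `i sin α`, so the
angles can be read off one cell after another (`IsRun.eq_of_row`).

For existence, a gate placed before a normal form has to be absorbed. It is pushed through the first
run, leaving a run followed by phases on wire `k` and gates below it (`IsRun.runForm_gate_mul`);
this residue is absorbed by the rest of the normal form. The essential case is a beam splitter
meeting the last cell of the run, where an Euler rule applies. Its right-hand side exists because
every unitary matrix of size 2 or 3 has a triangular decomposition (`exists_canonical2`,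
`exists_canonical3`). -/

namespace LOpp

/-! ### Soundness: the matrix is invariant under the PRO axioms and the rules -/

open Matrix

/-- The entry of a square matrix at two natural numbers, `0` out of range. -/
noncomputable def ent {n : ℕ} (M : Matrix (Fin n) (Fin n) ℂ) (a b : ℕ) : ℂ :=
  if h : a < n ∧ b < n then M ⟨a, h.1⟩ ⟨b, h.2⟩ else 0

theorem ent_val {n : ℕ} (M : Matrix (Fin n) (Fin n) ℂ) (a b : Fin n) : ent M a b = M a b := by
  simp [ent]

theorem ent_eq_zero {n : ℕ} (M : Matrix (Fin n) (Fin n) ℂ) {a b : ℕ} (h : ¬(a < n ∧ b < n)) :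
    ent M a b = 0 := dif_neg h

theorem ent_ext {n : ℕ} {M N : Matrix (Fin n) (Fin n) ℂ} (h : ∀ a b, ent M a b = ent N a b) :
    M = N := by
  ext a b
  have := h a b
  rwa [ent_val, ent_val] at this

theorem ent_one (n a b : ℕ) :
    ent (1 : Matrix (Fin n) (Fin n) ℂ) a b = if a < n ∧ b < n ∧ a = b then 1 else 0 := by
  unfold ent
  by_cases h : a < n ∧ b < n
  · simp [h, Matrix.one_apply]
  · rw [dif_neg h, if_neg (by tauto)]

namespace Term

theorem ent_sem_cast {n m : ℕ} (h : n = m) (f : Term n) (a b : ℕ) :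
    ent (sem (f.cast h)) a b = ent (sem f) a b := by
  subst h; rfl

/-- With indices in `ℕ`, the block structure is described without transport along equalities of
sizes, so unit and associativity laws become arithmetic of indices. -/
theorem ent_sem_tensor {n m : ℕ} (f : Term n) (g : Term m) (a b : ℕ) :
    ent (sem (tensor f g)) a b =
      if a < n ∧ b < n then ent (sem f) a b
      else if n ≤ a ∧ n ≤ b then ent (sem g) (a - n) (b - n) else 0 := by
  by_cases h : a < n + m ∧ b < n + m
  swap
  · rw [ent, dif_neg h]
    split_ifs
    · omega
    · rw [ent, dif_neg (by omega)]
    · rfl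
  obtain ⟨a', ha⟩ : ∃ a' : Fin (n + m), a = a' := ⟨⟨a, h.1⟩, rfl⟩
  obtain ⟨b', hb⟩ : ∃ b' : Fin (n + m), b = b' := ⟨⟨b, h.2⟩, rfl⟩
  subst ha hb
  rw [ent_val]
  clear h
  refine Fin.addCases (fun i => ?_) (fun i => ?_) a' <;>
    refine Fin.addCases (fun j => ?_) (fun j => ?_) b' <;>
    simp [sem, ent_val]

theorem sem_comp {n : ℕ} (f g : Term n) : sem (comp f g) = sem g * sem f := rfl

theorem sem_eq_of_proEq {n : ℕ} {f g : Term n} (h : ProEq f g) : sem f = sem g := by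
  induction h with
  | refl => rfl
  | symm _ ih => exact ih.symm
  | trans _ _ ih ih' => exact ih.trans ih'
  | comp_congr _ _ ih ih' => rw [sem_comp, sem_comp, ih, ih']
  | tensor_congr _ _ ih ih' => simp only [sem, ih, ih']
  | id_comp f => simp [sem]
  | comp_id f => simp [sem]
  | comp_assoc f g h => simp [sem, Matrix.mul_assoc]
  | tensor_id n m => simp [sem]
  | interchange f f' g g' =>
    simp only [sem]
    rw [Matrix.submatrix_mul_equiv, Matrix.fromBlocks_multiply]
    simp
  | empty_tensor f =>
    refine ent_ext fun a b => ?_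
    rw [ent_sem_cast, ent_sem_tensor]
    simp
  | @tensor_empty n f =>
    refine ent_ext fun a b => ?_
    rw [ent_sem_tensor]
    split_ifs with h h'
    · rfl
    · rw [ent, dif_neg (by omega)]
      exact (ent_eq_zero _ h).symm
    · exact (ent_eq_zero _ h).symm
  | tensor_assoc f g h =>
    refine ent_ext fun a b => ?_
    rw [ent_sem_cast]
    simp only [ent_sem_tensor, Nat.sub_sub]
    split_ifs <;> first | rfl | omega

theorem sem_par_ps (a b : ℝ) :
    sem (par (ps a) (ps b)) =
      !![Complex.exp (a * Complex.I), 0; 0, Complex.exp (b * Complex.I)] := by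
  refine ent_ext fun i j => ?_
  rw [par, ent_sem_tensor]
  by_cases h : i < 2 ∧ j < 2
  · obtain ⟨hi, hj⟩ := h
    interval_cases i <;> interval_cases j <;> simp [ent, sem]
  · rw [ent, ent, ent]
    split_ifs <;> first | rfl | omega

theorem sem_ps_zero : sem (ps 0) = sem (id 1) := by
  ext i j; fin_cases i; fin_cases j; simp [sem]

theorem sem_tensor_congr {n m : ℕ} {f f' : Term n} {g g' : Term m} (h : sem f = sem f')
    (h' : sem g = sem g') : sem (tensor f g) = sem (tensor f' g') := by
  simp only [sem, h, h']

theorem sem_par_ps_id (a : ℝ) :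
    sem (par (ps a) (id 1)) = !![Complex.exp (a * Complex.I), 0; 0, 1] := by
  have := sem_par_ps a 0
  rw [par, sem_tensor_congr rfl sem_ps_zero] at this
  rw [par, this]; simp

theorem sem_par_id_ps (a : ℝ) :
    sem (par (id 1) (ps a)) = !![1, 0; 0, Complex.exp (a * Complex.I)] := by
  have := sem_par_ps 0 a
  rw [par, sem_tensor_congr sem_ps_zero rfl] at this
  rw [par, this]; simp

end Term

open Term

theorem sem_eq_of_rule {Θ Φ : Set ℝ} {n : ℕ} {l r : Term n} (h : Rule Θ Φ l r) :
    sem l = sem r := by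
  have hmod (ψ : ℝ) : ∃ k : ℤ, toIcoMod Real.two_pi_pos 0 ψ = ψ - k * (2 * Real.pi) :=
    ⟨toIcoDiv Real.two_pi_pos 0 ψ, by rw [toIcoMod, zsmul_eq_mul]⟩
  have hexp (ψ : ℝ) (k : ℤ) : Complex.exp (((ψ - k * (2 * Real.pi) : ℝ) : ℂ) * Complex.I) =
      Complex.exp (ψ * Complex.I) := by
    rw [Complex.exp_eq_exp_iff_exists_int]
    exact ⟨-k, by push_cast; ring⟩
  cases h with
  | ps_mod ψ =>
    obtain ⟨k, hk⟩ := hmod ψ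
    rw [hk, sem, sem, hexp]
  | bs_mod ψ =>
    obtain ⟨k, hk⟩ := hmod ψ
    rw [hk, sem, sem, Real.cos_sub_int_mul_two_pi, Real.sin_sub_int_mul_two_pi]
  | ps_fusion =>
    ext i j; fin_cases i; fin_cases j
    simpa [sem, add_mul, Complex.exp_add] using mul_comm _ _
  | ps_zero => exact sem_ps_zero
  | bs_zero => ext i j; fin_cases i <;> fin_cases j <;> simp [sem]
  | bottom_phase φ θ =>
    have h : Complex.exp (-(φ * Complex.I)) * Complex.exp (φ * Complex.I) = 1 := by
      rw [← Complex.exp_add]; simp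
    simp only [seq, sem_comp, sem_par_id_ps, sem_par_ps_id, sem_par_ps, sem]
    ext i j; fin_cases i <;> fin_cases j <;> simp [Matrix.mul_apply, Fin.sum_univ_two]
    · linear_combination -Complex.cos θ * h
    · ring
    · linear_combination -(Complex.I * Complex.sin θ) * h
    · ring
  | pi_div_two φ =>
    simp only [sem_par_id_ps, sem_par_ps_id, sem]
    ext i j; fin_cases i <;> fin_cases j <;>
      simp [Matrix.mul_apply, Fin.sum_univ_two, mul_comm]
  | top_phase φ θ =>
    simp only [seq, sem_comp, sem_par_id_ps, sem_par_ps_id, sem]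
    have h : Complex.exp (((φ - Real.pi : ℝ) : ℂ) * Complex.I) =
        - Complex.exp (φ * Complex.I) := by
      rw [Complex.ofReal_sub, sub_mul, Complex.exp_sub, Complex.exp_pi_mul_I]; ring
    ext i j; fin_cases i <;> fin_cases j <;>
      simp [Matrix.mul_apply, Fin.sum_univ_two, h, -Complex.ofReal_sub]
  | bs_sub_pi θ =>
    simp only [sem_par_ps, sem]
    ext i j; fin_cases i <;> fin_cases j <;>
      simp [Matrix.mul_apply, Fin.sum_univ_two]
  | euler3 _ _ _ _ _ _ _ _ _ _ _ _ _ _ _ _ _ _ _ _ h => exact h.symm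
  | euler2 _ _ _ _ _ _ _ _ _ _ _ h => exact h.symm

/-! ### The monoid of circuits on `n` wires and its generators -/

namespace Circuit

/-- Circuits on `n` wires form a monoid under sequential composition; `C * D` is `C` followed by
`D`. -/
instance (n : ℕ) : Monoid (Circuit n) where
  mul := Circuit.comp
  one := mk (id n)
  mul_assoc a b c := by
    induction a, b, c using Quotient.inductionOn₃
    exact Quotient.sound (ProEq.comp_assoc _ _ _)
  one_mul a := by
    induction a using Quotient.inductionOn
    exact Quotient.sound (ProEq.id_comp _)
  mul_one a := by
    induction a using Quotient.inductionOn
    exact Quotient.sound (ProEq.comp_id _)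

theorem mk_comp {n : ℕ} (f g : Term n) : mk (Term.comp f g) = mk f * mk g := rfl

theorem mk_tensor {n m : ℕ} (f : Term n) (g : Term m) :
    mk (Term.tensor f g) = (mk f).tensor (mk g) := rfl

theorem mk_id (n : ℕ) : mk (id n) = 1 := rfl

theorem tensor_mul {n m : ℕ} (a b : Circuit n) (c d : Circuit m) :
    (a * b).tensor (c * d) = a.tensor c * b.tensor d := by
  induction a using Quotient.inductionOn
  induction b using Quotient.inductionOn
  induction c, d using Quotient.inductionOn₂
  exact Quotient.sound (ProEq.interchange _ _ _ _)

theorem one_tensor_one (n m : ℕ) :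
    (1 : Circuit n).tensor (1 : Circuit m) = 1 :=
  Quotient.sound (ProEq.tensor_id n m)

theorem mk_cast_heq {n m : ℕ} (h : n = m) (f : Term n) : HEq (mk (f.cast h)) (mk f) := by
  subst h; rfl

/-- The two sides live on sizes that are only propositionally equal. Heterogeneous equality is
confined to this group of lemmas; afterwards everything is expressed through `place` at a fixed
size. -/
theorem tensor_assoc_heq {n m k : ℕ} (a : Circuit n) (b : Circuit m) (c : Circuit k) :
    HEq ((a.tensor b).tensor c) (a.tensor (b.tensor c)) := by
  induction a, b, c using Quotient.inductionOn₃
  exact (mk_cast_heq (Nat.add_assoc n m k) _).symm.trans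
    (heq_of_eq (Quotient.sound (ProEq.tensor_assoc _ _ _)))

theorem empty_tensor_heq {n : ℕ} (a : Circuit n) : HEq ((1 : Circuit 0).tensor a) a := by
  induction a using Quotient.inductionOn
  exact (mk_cast_heq (Nat.zero_add n) _).symm.trans
    (heq_of_eq (Quotient.sound (ProEq.empty_tensor _)))

theorem tensor_empty {n : ℕ} (a : Circuit n) : a.tensor (1 : Circuit 0) = a := by
  induction a using Quotient.inductionOn
  exact Quotient.sound (ProEq.tensor_empty _)

theorem tensor_heq {n n' m m' : ℕ} (hn : n = n') (hm : m = m') {a : Circuit n} {a' : Circuit n'}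
    {b : Circuit m} {b' : Circuit m'} (ha : HEq a a') (hb : HEq b b') :
    HEq (a.tensor b) (a'.tensor b') := by
  subst hn hm; cases ha; cases hb; rfl

theorem one_heq {n n' : ℕ} (h : n = n') : HEq (1 : Circuit n) (1 : Circuit n') := by
  subst h; rfl

/-- The circuit `c` placed on the wires `i, i + 1, …` among `n` wires
(and the identity if there is no room). -/
def place {k : ℕ} (n i : ℕ) (c : Circuit k) : Circuit n :=
  if h : i + k ≤ n then
    cast (congrArg Circuit (by omega : i + k + (n - (i + k)) = n))
      (((1 : Circuit i).tensor c).tensor (1 : Circuit (n - (i + k))))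
  else 1

theorem place_heq {k n i r : ℕ} (h : i + k + r = n) (c : Circuit k) :
    HEq (place n i c) (((1 : Circuit i).tensor c).tensor (1 : Circuit r)) := by
  rw [place, dif_pos (by omega)]
  exact (cast_heq _ _).trans (tensor_heq rfl (by omega) HEq.rfl (one_heq (by omega)))

theorem place_add {k i r : ℕ} (c : Circuit k) :
    place (i + k + r) i c = ((1 : Circuit i).tensor c).tensor (1 : Circuit r) :=
  eq_of_heq (place_heq rfl c)

theorem place_one (k n i : ℕ) : place n i (1 : Circuit k) = 1 := by
  by_cases h : i + k ≤ n
  · obtain ⟨r, rfl⟩ := Nat.exists_eq_add_of_le h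
    rw [place_add, one_tensor_one, one_tensor_one]
  · rw [place, dif_neg h]

theorem place_mul {k n i : ℕ} (c d : Circuit k) :
    place n i (c * d) = place n i c * place n i d := by
  by_cases h : i + k ≤ n
  · obtain ⟨r, rfl⟩ := Nat.exists_eq_add_of_le h
    simp only [place_add, ← tensor_mul, mul_one]
  · simp [place, dif_neg h]

theorem place_zero {n : ℕ} (c : Circuit n) : place n 0 c = c := by
  refine eq_of_heq ((place_heq (r := 0) (by omega) c).trans ?_)
  rw [tensor_empty]
  exact empty_tensor_heq c

theorem place_tensor_one {k n i l : ℕ} (h : i + (k + l) ≤ n) (c : Circuit k) :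
    place n i (c.tensor (1 : Circuit l)) = place n i c := by
  obtain ⟨r, rfl⟩ := Nat.exists_eq_add_of_le h
  refine eq_of_heq ((place_heq rfl _).trans ?_)
  refine HEq.trans ?_ (place_heq (r := l + r) (by omega) c).symm
  refine (tensor_heq (by omega) rfl (tensor_assoc_heq _ _ _).symm HEq.rfl).trans ?_
  refine (tensor_assoc_heq _ _ _).trans ?_
  rw [one_tensor_one]

theorem place_one_tensor {k n i l : ℕ} (h : i + (l + k) ≤ n) (c : Circuit k) :
    place n i ((1 : Circuit l).tensor c) = place n (i + l) c := by
  obtain ⟨r, rfl⟩ := Nat.exists_eq_add_of_le h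
  refine eq_of_heq ((place_heq rfl _).trans ?_)
  refine HEq.trans ?_ (place_heq (r := r) (by omega) c).symm
  refine tensor_heq (by omega) rfl ((tensor_assoc_heq _ _ _).symm.trans ?_) HEq.rfl
  rw [one_tensor_one]

theorem place_tensor {k l n i : ℕ} (h : i + (k + l) ≤ n) (c : Circuit k) (d : Circuit l) :
    place n i (c.tensor d) = place n i c * place n (i + k) d := by
  rw [← place_tensor_one h, ← place_one_tensor h, ← place_mul, ← tensor_mul, mul_one, one_mul]

/-- This is the interchange law: both factors are written as tensor products on one common block of
wires, each acting as the identity where the other acts. -/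
theorem place_commute {k l n i j : ℕ} (hij : i + k ≤ j) (hj : j + l ≤ n) (c : Circuit k)
    (d : Circuit l) : Commute (place n i c) (place n j d) := by
  obtain ⟨m, rfl⟩ := Nat.exists_eq_add_of_le hij
  have h : i + ((k + m) + l) ≤ n := by omega
  have h1 : place n i c = place n i ((c.tensor (1 : Circuit m)).tensor (1 : Circuit l)) := by
    rw [place_tensor_one h, place_tensor_one (by omega)]
  have h2 : place n (i + k + m) d = place n i ((1 : Circuit (k + m)).tensor d) := by
    rw [place_one_tensor h, Nat.add_assoc]
  rw [Commute, SemiconjBy, h1, h2, ← place_mul, ← place_mul, ← tensor_mul, ← tensor_mul]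
  simp only [mul_one, one_mul]

/-- The phase shifter `φ` on wire `i`. -/
def P (n i : ℕ) (φ : ℝ) : Circuit n := place n i (mk (ps φ))

/-- The beam splitter `θ` on wires `i` and `i + 1`. -/
def B (n i : ℕ) (θ : ℝ) : Circuit n := place n i (mk (bs θ))

/-- The phase shifter `φ` on wire `i`, left out if `φ = 0`. -/
noncomputable def Ps (n i : ℕ) (φ : ℝ) : Circuit n := if φ = 0 then 1 else P n i φ

/-- Generators on the wires `k, k + 1, …`. -/
inductive IsGate (n k : ℕ) : Circuit n → Prop
  | phase {i : ℕ} (φ : ℝ) : k ≤ i → i < n → IsGate n k (P n i φ)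
  | beam {i : ℕ} (θ : ℝ) : k ≤ i → i + 1 < n → IsGate n k (B n i θ)

/-- Circuits on the wires `k, k + 1, …`. -/
def Gen (n k : ℕ) : Submonoid (Circuit n) := Submonoid.closure {g | IsGate n k g}

theorem place_mem_gen {k : ℕ} (t : Term k) (n i : ℕ) (h : i + k ≤ n) :
    place n i (mk t) ∈ Gen n 0 := by
  induction t generalizing i with
  | id m => rw [mk_id, place_one]; exact one_mem _
  | ps φ => exact Submonoid.subset_closure (.phase φ (Nat.zero_le _) (by omega))
  | bs θ => exact Submonoid.subset_closure (.beam θ (Nat.zero_le _) (by omega))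
  | comp f g ihf ihg => rw [mk_comp, place_mul]; exact mul_mem (ihf i h) (ihg i h)
  | tensor f g ihf ihg =>
    rw [mk_tensor, place_tensor h]
    exact mul_mem (ihf i (by omega)) (ihg _ (by omega))

theorem mem_gen_zero {n : ℕ} (c : Circuit n) : c ∈ Gen n 0 := by
  induction c using Quotient.inductionOn with
  | h t =>
    have := place_mem_gen t n 0 (by omega)
    rwa [place_zero] at this

end Circuit

/-! ### Rewriting in context, and the one- and two-wire rules on `n` wires -/

open Circuit

theorem Step.place {Θ Φ : Set ℝ} {k : ℕ} {c d : Circuit k} (h : Step Θ Φ c d) {n i : ℕ}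
    (hi : i + k ≤ n) : Step Θ Φ (place n i c) (place n i d) := by
  obtain ⟨r, rfl⟩ := Nat.exists_eq_add_of_le hi
  rw [place_add, place_add]
  exact (h.tensor_right _).tensor_left _

/-- Rewriting in any number of steps. -/
abbrev Steps (n : ℕ) : Circuit n → Circuit n → Prop := Relation.ReflTransGen (PPRS n)

theorem Steps.mul {n : ℕ} {a b c d : Circuit n} (h : Steps n a b) (h' : Steps n c d) :
    Steps n (a * c) (b * d) :=
  (h.lift (· * c) fun _ _ s => Step.comp_left c s).trans
    (h'.lift (b * ·) fun _ _ s => Step.comp_right b s)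

theorem Steps.mul_left {n : ℕ} (a : Circuit n) {c d : Circuit n} (h' : Steps n c d) :
    Steps n (a * c) (a * d) := Steps.mul .refl h'

theorem Steps.mul_right {n : ℕ} {a b : Circuit n} (h : Steps n a b) (c : Circuit n) :
    Steps n (a * c) (b * c) := Steps.mul h .refl

theorem Steps.of_rule {k : ℕ} {l r : Term k}
    (h : Rule (Set.Ioo 0 Real.pi) (Set.Ioo 0 (2 * Real.pi)) l r) {n i : ℕ} (hi : i + k ≤ n) :
    Steps n (Circuit.place n i (mk l)) (Circuit.place n i (mk r)) :=
  .single ((Step.rule h).place hi)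

namespace Circuit

variable {n i : ℕ}

theorem place_par (h : i + 2 ≤ n) (f g : Term 1) :
    place n i (mk (par f g)) = place n i (mk f) * place n (i + 1) (mk g) :=
  place_tensor (k := 1) (l := 1) h (mk f) (mk g)

theorem place_top (h : i + 3 ≤ n) (f : Term 2) :
    place n i (mk (top f)) = place n i (mk f) :=
  place_tensor_one (k := 2) (l := 1) h (mk f)

theorem place_bot (h : i + 3 ≤ n) (f : Term 2) :
    place n i (mk (bot f)) = place n (i + 1) (mk f) :=
  place_one_tensor (k := 2) (l := 1) h (mk f)

theorem place_par3 (h : i + 3 ≤ n) (f g k : Term 1) :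
    place n i (mk (par3 f g k)) =
      place n i (mk f) * (place n (i + 1) (mk g) * place n (i + 2) (mk k)) :=
  (place_tensor (k := 1) (l := 2) h (mk f) (mk (par g k))).trans
    (congrArg _ (place_par (by omega) g k))

theorem place_psStar (f : Option ℝ) :
    place n i (mk (psStar f)) = f.elim 1 (P n i) := by
  cases f with
  | none => exact place_one _ _ _
  | some φ => rfl

end Circuit

section Rules

open Circuit Set Real

variable {n i : ℕ}

theorem steps_P_Ps_mod (hi : i < n) (φ : ℝ) :
    Steps n (P n i φ) (Ps n i (toIcoMod two_pi_pos 0 φ)) := by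
  have h1 : Steps n (P n i φ) (P n i (toIcoMod two_pi_pos 0 φ)) := by
    by_cases h : φ ∈ Ico 0 (2 * π)
    · rw [(toIcoMod_eq_self two_pi_pos).2 (by simpa using h)]
    · exact Steps.of_rule (.ps_mod φ h) hi
  refine h1.trans ?_
  rw [Ps]
  split_ifs with h
  · rw [h]
    have := Steps.of_rule (n := n) (i := i) .ps_zero hi
    rwa [mk_id, place_one] at this
  · exact .refl

theorem steps_P_Ps (hi : i < n) {φ : ℝ} (h : φ ∈ Ico 0 (2 * π)) :
    Steps n (P n i φ) (Ps n i φ) := by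
  have := steps_P_Ps_mod hi φ
  rwa [(toIcoMod_eq_self two_pi_pos).2 (by simpa using h)] at this

theorem exists_steps_P (hi : i < n) (φ : ℝ) :
    ∃ ψ ∈ Ico 0 (2 * π), Steps n (P n i φ) (Ps n i ψ) :=
  ⟨_, by simpa using toIcoMod_mem_Ico two_pi_pos 0 φ, steps_P_Ps_mod hi φ⟩

theorem exists_steps_Ps_mul_Ps (hi : i < n) {φ ψ : ℝ} (hφ : φ ∈ Ico 0 (2 * π))
    (hψ : ψ ∈ Ico 0 (2 * π)) :
    ∃ χ ∈ Ico 0 (2 * π), Steps n (Ps n i φ * Ps n i ψ) (Ps n i χ) := by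
  by_cases h : φ = 0
  · exact ⟨ψ, hψ, by rw [Ps, if_pos h, one_mul]⟩
  by_cases h' : ψ = 0
  · exact ⟨φ, hφ, by rw [h', Ps, Ps, if_pos rfl, mul_one]⟩
  obtain ⟨χ, hχ, hs⟩ := exists_steps_P hi (φ + ψ)
  refine ⟨χ, hχ, .trans ?_ hs⟩
  rw [Ps, Ps, if_neg h, if_neg h']
  have := Steps.of_rule (n := n) (i := i)
    (.ps_fusion φ ψ ⟨lt_of_le_of_ne hφ.1 (Ne.symm h), hφ.2⟩
      ⟨lt_of_le_of_ne hψ.1 (Ne.symm h'), hψ.2⟩) hi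
  rwa [mk_comp, place_mul] at this

theorem exists_steps_P_mul_Ps (hi : i < n) (φ : ℝ) {ψ : ℝ} (hψ : ψ ∈ Ico 0 (2 * π)) :
    ∃ χ ∈ Ico 0 (2 * π), Steps n (P n i φ * Ps n i ψ) (Ps n i χ) := by
  obtain ⟨φ', h, hs⟩ := exists_steps_P hi φ
  obtain ⟨χ, hχ, hs'⟩ := exists_steps_Ps_mul_Ps hi h hψ
  exact ⟨χ, hχ, (hs.mul_right _).trans hs'⟩

theorem steps_B_zero (hi : i + 1 < n) : Steps n (B n i 0) 1 := by
  have := Steps.of_rule (n := n) (i := i) .bs_zero hi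
  rwa [mk_id, place_one] at this

/-- A beam splitter reduces to one with angle in `[0, π)`, up to phase shifters after it. -/
theorem exists_steps_B (hi : i + 1 < n) (θ : ℝ) :
    ∃ θ' ∈ Ico 0 π, Steps n (B n i θ) (B n i θ') ∨
      Steps n (B n i θ) (B n i θ' * (P n i π * P n (i + 1) π)) := by
  have h1 : Steps n (B n i θ) (B n i (toIcoMod two_pi_pos 0 θ)) := by
    by_cases h : θ ∈ Ico 0 (2 * π)
    · rw [(toIcoMod_eq_self two_pi_pos).2 (by simpa using h)]
    · exact Steps.of_rule (.bs_mod θ h) hi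
  have h2 : toIcoMod two_pi_pos 0 θ ∈ Ico 0 (2 * π) := by
    simpa using toIcoMod_mem_Ico two_pi_pos 0 θ
  generalize toIcoMod two_pi_pos 0 θ = ψ at h1 h2
  by_cases h : ψ < π
  · exact ⟨ψ, ⟨h2.1, h⟩, .inl h1⟩
  · refine ⟨ψ - π, ⟨by linarith, by linarith [h2.2]⟩, .inr (h1.trans ?_)⟩
    have := Steps.of_rule (n := n) (i := i) (.bs_sub_pi ψ ⟨by linarith, h2.2⟩) hi
    rwa [mk_comp, place_mul, place_par hi] at this

theorem steps_bottom_phase (hi : i + 1 < n) {φ θ : ℝ} (hφ : φ ∈ Ioo 0 (2 * π))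
    (hθ : θ ∈ Ioo 0 π) :
    Steps n (P n (i + 1) φ * B n i θ) (P n i (-φ) * (B n i θ * (P n i φ * P n (i + 1) φ))) := by
  have := Steps.of_rule (n := n) (i := i) (.bottom_phase φ θ hφ hθ) hi
  simpa only [P, B, Term.seq, mk_comp, place_mul, place_par (Nat.succ_le_of_lt hi), mk_id, place_one, one_mul,
    mul_one] using this

theorem steps_pi_div_two (hi : i + 1 < n) {φ : ℝ} (hφ : φ ∈ Ioo 0 (2 * π)) :
    Steps n (P n i φ * B n i (π / 2)) (B n i (π / 2) * P n (i + 1) φ) := by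
  have := Steps.of_rule (n := n) (i := i) (.pi_div_two φ hφ) hi
  simpa only [P, B, Term.seq, mk_comp, place_mul, place_par (Nat.succ_le_of_lt hi), mk_id, place_one, one_mul,
    mul_one] using this

theorem steps_top_phase (hi : i + 1 < n) {φ θ : ℝ} (hφ : φ ∈ Ico π (2 * π))
    (hθ : θ ∈ Ioo 0 π) (hθ' : θ ≠ π / 2) :
    Steps n (P n i φ * B n i θ) (P n i (φ - π) * (B n i (π - θ) * P n (i + 1) π)) := by
  have := Steps.of_rule (n := n) (i := i) (.top_phase φ θ hφ hθ hθ') hi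
  simpa only [P, B, Term.seq, mk_comp, place_mul, place_par (Nat.succ_le_of_lt hi), mk_id, place_one, one_mul,
    mul_one] using this

end Rules

/-! ### Unitarity and triangular decompositions of 2 × 2 and 3 × 3 unitary matrices -/

namespace Term

theorem sem_mul_conjTranspose {n : ℕ} (t : Term n) : sem t * (sem t)ᴴ = 1 := by
  induction t with
  | id n => simp [sem]
  | ps φ =>
    ext i j; fin_cases i; fin_cases j
    simp [sem, Matrix.mul_apply, ← Complex.exp_conj, ← Complex.exp_add]
  | bs θ =>
    have h : Complex.cos θ * Complex.cos θ + Complex.sin θ * Complex.sin θ = 1 := by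
      rw [← sq, ← sq, Complex.cos_sq_add_sin_sq]
    ext i j; fin_cases i <;> fin_cases j <;>
      simp [sem, Matrix.mul_apply, Fin.sum_univ_two, ← Complex.cos_conj, ← Complex.sin_conj]
    · linear_combination h - Complex.sin θ * Complex.sin θ * Complex.I_sq
    · ring
    · ring
    · linear_combination h - Complex.sin θ * Complex.sin θ * Complex.I_sq
  | comp f g ihf ihg =>
    rw [sem_comp, conjTranspose_mul, Matrix.mul_assoc, ← Matrix.mul_assoc (sem f), ihf,
      Matrix.one_mul, ihg]
  | tensor f g ihf ihg =>
    rw [sem, conjTranspose_submatrix, submatrix_mul_equiv, fromBlocks_conjTranspose,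
      fromBlocks_multiply]
    simp [ihf, ihg]

theorem sem_tensor_one_two (f : Term 1) (g : Term 2) :
    sem (n := 3) (tensor f g) =
      !![sem f 0 0, 0, 0; 0, sem g 0 0, sem g 0 1; 0, sem g 1 0, sem g 1 1] := by
  refine ent_ext fun i j => ?_
  rw [ent_sem_tensor]
  by_cases h : i < 3 ∧ j < 3
  · obtain ⟨hi, hj⟩ := h
    interval_cases i <;> interval_cases j <;> simp [ent]
  · rw [ent, ent, ent]
    split_ifs <;> first | rfl | omega

theorem sem_top (f : Term 2) :
    sem (top f) = !![sem f 0 0, sem f 0 1, 0; sem f 1 0, sem f 1 1, 0; 0, 0, 1] := by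
  refine ent_ext fun i j => ?_
  rw [top, ent_sem_tensor]
  by_cases h : i < 3 ∧ j < 3
  · obtain ⟨hi, hj⟩ := h
    interval_cases i <;> interval_cases j <;> simp [ent, sem]
  · rw [ent, ent, ent]
    split_ifs <;> first | rfl | omega

end Term

section Euler

open Complex Set Real

/-- Polar form with a signed modulus: the sign absorbs a half turn, which brings the angle into `[0,
π)`. -/
theorem exists_eq_ofReal_mul_exp (w : ℂ) :
    ∃ r β : ℝ, β ∈ Ico 0 π ∧ (r = 0 → β = 0) ∧ w = r * cexp (β * I) := by
  by_cases hw : w = 0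
  · exact ⟨0, 0, ⟨le_rfl, pi_pos⟩, fun _ => rfl, by simp [hw]⟩
  have hn : ‖w‖ ≠ 0 := norm_ne_zero_iff.2 hw
  have hp := Complex.norm_mul_exp_arg_mul_I w
  have h1 := Complex.neg_pi_lt_arg w
  have h2 := Complex.arg_le_pi w
  have hneg : -cexp (w.arg * I) = cexp (w.arg * I + π * I) := by
    rw [Complex.exp_add, Complex.exp_pi_mul_I]; ring
  rcases lt_or_ge w.arg 0 with h | h
  · refine ⟨-‖w‖, w.arg + π, ⟨by linarith, by linarith⟩, fun h => absurd (neg_eq_zero.1 h) hn, ?_⟩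
    rw [ofReal_add, add_mul, ← hneg]
    push_cast
    linear_combination -hp
  · rcases lt_or_eq_of_le h2 with h3 | h3
    · exact ⟨‖w‖, w.arg, ⟨h, h3⟩, fun h => absurd h hn, hp.symm⟩
    · refine ⟨-‖w‖, 0, ⟨le_rfl, pi_pos⟩, fun _ => rfl, ?_⟩
      rw [h3, Complex.exp_pi_mul_I] at hp
      simp only [ofReal_zero, zero_mul, Complex.exp_zero, mul_one, ofReal_neg]
      linear_combination -hp

/-- Every vector of length two is a multiple of the first row of a phase shifter on the top wire
followed by a beam splitter. -/
theorem exists_euler_angles (x y : ℂ) :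
    ∃ (c : ℂ) (α β : ℝ), α ∈ Ico 0 π ∧ β ∈ Ico 0 π ∧ (α = 0 ∨ α = π / 2 → β = 0) ∧
      (y = 0 → α = 0) ∧ x = c * ((Real.cos α : ℂ) * cexp (β * I)) ∧
      y = c * (I * (Real.sin α : ℂ)) := by
  by_cases hy : y = 0
  · exact ⟨x, 0, 0, ⟨le_rfl, pi_pos⟩, ⟨le_rfl, pi_pos⟩, fun _ => rfl, fun _ => rfl,
      by simp, by simp [hy]⟩
  -- The wanted equations force `x * I / y = cot α · exp(iβ)`, so `r` has to be the cotangent of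
  -- `α`, whence `α = π / 2 - arctan r`.
  obtain ⟨r, β, hβ, hr, hw⟩ := exists_eq_ofReal_mul_exp (x * I / y)
  have hc := Real.cos_arctan_pos r
  have hc' : ((Real.cos (Real.arctan r) : ℝ) : ℂ) ≠ 0 := ofReal_ne_zero.2 hc.ne'
  have hs : Real.sin (Real.arctan r) = r * Real.cos (Real.arctan r) := by
    rw [← Real.tan_mul_cos hc.ne', Real.tan_arctan]
  have h1 := Real.arctan_lt_pi_div_two r
  have h2 := Real.neg_pi_div_two_lt_arctan r
  refine ⟨y / (I * Real.cos (Real.arctan r)), π / 2 - Real.arctan r, β,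
    ⟨by linarith, by linarith⟩, hβ, ?_, fun h => absurd h hy, ?_, ?_⟩
  · rintro (h | h)
    · linarith
    · exact hr (by rw [← Real.tan_arctan r, (by linarith : Real.arctan r = 0), Real.tan_zero])
  · rw [Real.cos_pi_div_two_sub, hs]
    rw [div_eq_iff hy] at hw
    generalize cexp (β * I) = e at hw ⊢
    push_cast at hc' ⊢
    field_simp
    linear_combination hw
  · rw [Real.sin_pi_div_two_sub]
    field_simp

theorem exists_eq_exp_of_norm_eq_one {c : ℂ} (h : ‖c‖ = 1) :
    ∃ β ∈ Ico 0 (2 * π), c = cexp (β * I) := by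
  refine ⟨toIcoMod two_pi_pos 0 c.arg, by simpa using toIcoMod_mem_Ico two_pi_pos 0 c.arg, ?_⟩
  have hp := Complex.norm_mul_exp_arg_mul_I c
  rw [h, ofReal_one, one_mul] at hp
  rw [← hp, Complex.exp_eq_exp_iff_exists_int]
  refine ⟨toIcoDiv two_pi_pos 0 c.arg, ?_⟩
  rw [hp, toIcoMod, zsmul_eq_mul]
  push_cast
  ring

/-- A unitary matrix whose first row is a multiple of that of `S` factors through `S`, leaving a
block diagonal matrix. -/
theorem exists_factor {m : ℕ} {U S : Matrix (Fin (m + 1)) (Fin (m + 1)) ℂ} (hU : U * Uᴴ = 1)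
    (hS : S * Sᴴ = 1) {c : ℂ} (h : ∀ k, U 0 k = c * S 0 k) :
    ∃ W : Matrix (Fin (m + 1)) (Fin (m + 1)) ℂ, U = W * S ∧ W * Wᴴ = 1 ∧ W 0 0 = c ∧ ‖c‖ = 1 ∧
      ∀ j, j ≠ 0 → W 0 j = 0 ∧ W j 0 = 0 := by
  have hS' : Sᴴ * S = 1 := mul_eq_one_comm.1 hS
  have hW : (U * Sᴴ) * (U * Sᴴ)ᴴ = 1 := by
    rw [conjTranspose_mul, conjTranspose_conjTranspose, Matrix.mul_assoc, ← Matrix.mul_assoc Sᴴ,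
      hS', Matrix.one_mul, hU]
  have hrow (j) : (U * Sᴴ) 0 j = c * (1 : Matrix (Fin (m + 1)) (Fin (m + 1)) ℂ) 0 j := by
    rw [← hS, Matrix.mul_apply, Matrix.mul_apply, Finset.mul_sum]
    exact Finset.sum_congr rfl fun k _ => by rw [h, mul_assoc]
  have hrow0 : (U * Sᴴ) 0 0 = c := by rw [hrow, one_apply_eq, mul_one]
  have hrow1 (j) (hj : j ≠ 0) : (U * Sᴴ) 0 j = 0 := by rw [hrow, one_apply_ne hj.symm, mul_zero]
  -- Row `0` of `W = U * Sᴴ` is `c` times a unit vector, so row `0` of `W * Wᴴ = 1` only involves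
  -- column `0` of `W`. This gives both `‖c‖ = 1` and the vanishing of the rest of that column.
  have hprod (j) : c * star ((U * Sᴴ) j 0) =
      (1 : Matrix (Fin (m + 1)) (Fin (m + 1)) ℂ) 0 j := by
    generalize U * Sᴴ = V at hW hrow0 hrow1
    rw [← hW, Matrix.mul_apply, Finset.sum_eq_single 0]
    · rw [hrow0, conjTranspose_apply]
    · intro k _ hk
      rw [hrow1 k hk, zero_mul]
    · simp
  have hc : ‖c‖ = 1 := by
    have := hprod 0
    rw [hrow0, one_apply_eq, ← starRingEnd_apply, Complex.mul_conj'] at this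
    have h2 : ‖c‖ ^ 2 = 1 := by exact_mod_cast this
    nlinarith [norm_nonneg c]
  refine ⟨U * Sᴴ, by rw [Matrix.mul_assoc, hS', Matrix.mul_one], hW, hrow0, hc,
    fun j hj => ⟨hrow1 j hj, ?_⟩⟩
  have := hprod j
  rw [one_apply_ne hj.symm, mul_eq_zero] at this
  rcases this with h0 | h0
  · simp [h0] at hc
  · exact star_eq_zero.1 h0

/-- The first cell is chosen to match the first row of `U` up to a scalar. What remains is a
diagonal unitary matrix, that is, two phases. -/
theorem exists_canonical2 {U : Matrix (Fin 2) (Fin 2) ℂ} (hU : U * Uᴴ = 1) :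
    ∃ α₁ β₁ β₂ β₃ : ℝ, Canonical2 α₁ β₁ β₂ β₃ ∧ sem (tri2 α₁ β₁ β₂ β₃) = U := by
  obtain ⟨c, α, β, hα, hβ, h, -, h0, h1⟩ := exists_euler_angles (U 0 0) (U 0 1)
  have hS := sem_mul_conjTranspose (comp (par (ps β) (id 1)) (bs α))
  obtain ⟨W, hUW, hW, hc, hc1, hz⟩ := exists_factor hU hS (c := c) (by
    intro k
    fin_cases k <;> simp [sem_par_ps_id, sem, Matrix.mul_apply, Fin.sum_univ_two, h0, h1])
  obtain ⟨z, z'⟩ := hz 1 (by simp)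
  have hd : ‖W 1 1‖ = 1 := by
    have := congrFun (congrFun hW 1) 1
    rw [Matrix.mul_apply, Fin.sum_univ_two, z', zero_mul, zero_add, conjTranspose_apply,
      ← starRingEnd_apply, Complex.mul_conj', one_apply_eq] at this
    have h2 : ‖W 1 1‖ ^ 2 = 1 := by exact_mod_cast this
    nlinarith [norm_nonneg (W 1 1)]
  obtain ⟨β₂, hβ₂, e₂⟩ := exists_eq_exp_of_norm_eq_one hc1
  obtain ⟨β₃, hβ₃, e₃⟩ := exists_eq_exp_of_norm_eq_one hd
  refine ⟨α, β, β₂, β₃, ⟨hα, hβ, hβ₂, hβ₃, h⟩, ?_⟩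
  have hW' : W = sem (par (ps β₂) (ps β₃)) := by
    rw [sem_par_ps]
    ext i j; fin_cases i <;> fin_cases j <;> simp [z, z', ← e₂, ← e₃, hc]
  rw [hUW, hW']
  simp only [tri2, Term.seq, sem_comp, Matrix.mul_assoc]

theorem exists_canonical3 {U : Matrix (Fin 3) (Fin 3) ℂ} (hU : U * Uᴴ = 1) :
    ∃ α₁ α₂ α₃ β₁ β₂ β₃ β₄ β₅ β₆ : ℝ, Canonical3 α₁ α₂ α₃ β₁ β₂ β₃ β₄ β₅ β₆ ∧
      sem (tri3 α₁ α₂ α₃ β₁ β₂ β₃ β₄ β₅ β₆) = U := by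
  -- The first row is matched in two stages: its last two entries are `c₁` times the row of the
  -- first cell, and `(U 0 0, c₁)` is `c` times the row of the second. The remaining 2 × 2 block is
  -- left to `exists_canonical2`.
  obtain ⟨c₁, α₁, β₁, hα₁, hβ₁, k₁, l₁, h1, h2⟩ := exists_euler_angles (U 0 1) (U 0 2)
  obtain ⟨c, α₂, β₂, hα₂, hβ₂, k₂, l₂, h0, h12⟩ := exists_euler_angles (U 0 0) c₁
  have hS := sem_mul_conjTranspose (comp (bot (comp (par (ps β₁) (id 1)) (bs α₁)))
    (top (comp (par (ps β₂) (id 1)) (bs α₂))))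
  obtain ⟨W, hUW, hW, hc, hc1, hz⟩ := exists_factor hU hS (c := c) (by
    intro k
    rw [sem_comp, sem_top, bot, sem_tensor_one_two]
    fin_cases k <;> simp [sem_par_ps_id, sem, Matrix.mul_apply, Fin.sum_univ_three,
      Fin.sum_univ_two, h0, h1, h2, h12] <;> ring)
  obtain ⟨z1, z1'⟩ := hz 1 (by simp)
  obtain ⟨z2, z2'⟩ := hz 2 (by simp)
  have hV : !![W 1 1, W 1 2; W 2 1, W 2 2] * (!![W 1 1, W 1 2; W 2 1, W 2 2])ᴴ = 1 := by
    ext i j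
    have := congrFun (congrFun hW i.succ) j.succ
    rw [Matrix.mul_apply, Fin.sum_univ_three] at this
    fin_cases i <;> fin_cases j <;>
      simpa [z1', z2', Matrix.mul_apply, Fin.sum_univ_two] using this
  obtain ⟨α₃, β₃, β₅, β₆, ⟨hα₃, hβ₃, hβ₅, hβ₆, k₃⟩, hV'⟩ := exists_canonical2 hV
  obtain ⟨β₄, hβ₄, e₄⟩ := exists_eq_exp_of_norm_eq_one hc1
  refine ⟨α₁, α₂, α₃, β₁, β₂, β₃, β₄, β₅, β₆,
    ⟨hα₁, hα₂, hα₃, hβ₁, hβ₂, hβ₃, hβ₄, hβ₅, hβ₆, k₁, k₂, k₃, fun h => l₁ ?_⟩, ?_⟩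
  -- If `α₂ = 0` then `c₁ = 0`, hence `U 0 2 = 0`, in which case `α₁` was chosen to be `0`.
  · rw [h2, h12, h]; simp
  have hW' : W = sem (n := 3) (tensor (ps β₄) (tri2 α₃ β₃ β₅ β₆)) := by
    rw [sem_tensor_one_two, hV']
    ext i j; fin_cases i <;> fin_cases j <;> simp [z1, z1', z2, z2', sem, hc, e₄]
  -- Multiplicativity on a block of wires comes from soundness of the interchange law, with no
  -- computation on entries.
  have hb (f g : Term 2) : sem (bot (comp f g)) = sem (bot g) * sem (bot f) := by
    rw [← sem_comp]
    exact sem_eq_of_proEq ((ProEq.tensor_congr (ProEq.symm (ProEq.id_comp _)) (ProEq.refl _)).trans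
      (ProEq.interchange _ _ _ _))
  have ht (f g : Term 2) : sem (top (comp f g)) = sem (top g) * sem (top f) := by
    rw [← sem_comp]
    exact sem_eq_of_proEq ((ProEq.tensor_congr (ProEq.refl _) (ProEq.symm (ProEq.id_comp _))).trans
      (ProEq.interchange _ _ _ _))
  have hp (a : Term 1) (f g : Term 2) :
      sem (n := 3) (tensor a (comp f g)) = sem (n := 3) (tensor a g) * sem (bot f) := by
    rw [← sem_comp]
    exact sem_eq_of_proEq ((ProEq.tensor_congr (ProEq.symm (ProEq.id_comp _)) (ProEq.refl _)).trans
      (ProEq.interchange _ _ _ _))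
  have h3 : sem (par3 (ps β₄) (ps β₅) (ps β₆)) =
      sem (n := 3) (tensor (ps β₄) (par (ps β₅) (ps β₆))) := rfl
  rw [hUW, hW']
  simp only [tri2, tri3, Term.seq, hp, hb, ht, sem_comp, h3, Matrix.mul_assoc]

end Euler

/-! ### The Euler rules on `n` wires -/

section EulerSteps

open Circuit Set Real

variable {n i : ℕ}

theorem place_psStar_ite (β : ℝ) :
    place n i (Circuit.mk (psStar (if β = 0 then none else some β))) = Ps n i β := by
  rw [place_psStar, Ps]
  split_ifs <;> rfl

theorem mem_Ioo_of_mem_ite {β : ℝ} (h : β ∈ Ico 0 (2 * π)) :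
    ∀ φ ∈ (if β = 0 then none else some β : Option ℝ), φ ∈ Ioo 0 (2 * π) := by
  intro φ hφ
  split_ifs at hφ with h0
  · simp at hφ
  · simp only [Option.mem_def, Option.some.injEq] at hφ
    subst hφ
    exact ⟨lt_of_le_of_ne h.1 (Ne.symm h0), h.2⟩

/-- The rule takes the canonical angles as given; unitarity of the left-hand side supplies them. A
zero phase corresponds to the empty choice of the starred phase shifter. -/
theorem exists_steps_euler2 (hi : i + 1 < n) {θ₁ θ₂ φ : ℝ} (h₁ : θ₁ ∈ Ioo 0 π) (h₂ : θ₂ ∈ Ioo 0 π)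
    (hφ : φ ∈ Ico 0 (2 * π)) :
    ∃ α₁ β₁ β₂ β₃ : ℝ, Canonical2 α₁ β₁ β₂ β₃ ∧
      Steps n (B n i θ₁ * (Ps n i φ * B n i θ₂))
        (P n i β₁ * (B n i α₁ * (P n i β₂ * P n (i + 1) β₃))) := by
  obtain ⟨α₁, β₁, β₂, β₃, hc, hs⟩ := exists_canonical2 (sem_mul_conjTranspose
    (Term.seq [bs θ₁, par (psStar (if φ = 0 then none else some φ)) (id 1), bs θ₂]))
  refine ⟨α₁, β₁, β₂, β₃, hc, ?_⟩
  have := Steps.of_rule (n := n) (i := i)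
    (.euler2 _ _ _ _ _ _ _ h₁ h₂ (mem_Ioo_of_mem_ite hφ) hc hs) hi
  simpa only [P, B, tri2, Term.seq, mk_comp, place_mul, place_par (Nat.succ_le_of_lt hi), mk_id,
    place_one, one_mul, mul_one, place_psStar_ite] using this

theorem exists_steps_euler3 (hi : i + 2 < n) {θ₁ θ₂ θ₃ φ₁ φ₂ : ℝ} (h₁ : θ₁ ∈ Ioo 0 π)
    (h₂ : θ₂ ∈ Ioo 0 π) (h₃ : θ₃ ∈ Ioo 0 π) (hφ₁ : φ₁ ∈ Ico 0 (2 * π))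
    (hφ₂ : φ₂ ∈ Ico 0 (2 * π)) :
    ∃ α₁ α₂ α₃ β₁ β₂ β₃ β₄ β₅ β₆ : ℝ, Canonical3 α₁ α₂ α₃ β₁ β₂ β₃ β₄ β₅ β₆ ∧
      Steps n (B n i θ₁ * (Ps n i φ₂ * Ps n (i + 1) φ₁ * (B n (i + 1) θ₂ * B n i θ₃)))
        (P n (i + 1) β₁ * (B n (i + 1) α₁ * (P n i β₂ * (B n i α₂ *
          (P n (i + 1) β₃ * (B n (i + 1) α₃ *
            (P n i β₄ * (P n (i + 1) β₅ * P n (i + 2) β₆)))))))) := by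
  obtain ⟨α₁, α₂, α₃, β₁, β₂, β₃, β₄, β₅, β₆, hc, hs⟩ := exists_canonical3 (sem_mul_conjTranspose
    (Term.seq [top (bs θ₁), par3 (psStar (if φ₂ = 0 then none else some φ₂))
      (psStar (if φ₁ = 0 then none else some φ₁)) (id 1), bot (bs θ₂), top (bs θ₃)]))
  refine ⟨α₁, α₂, α₃, β₁, β₂, β₃, β₄, β₅, β₆, hc, ?_⟩
  have := Steps.of_rule (n := n) (i := i)
    (.euler3 _ _ _ _ _ _ _ _ _ _ _ _ _ _ h₁ h₂ h₃ (mem_Ioo_of_mem_ite hφ₁)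
      (mem_Ioo_of_mem_ite hφ₂) hc hs) hi
  have hi' : i + 3 ≤ n := hi
  have hi'' : i + 1 + 2 ≤ n := hi
  have hi''' : i + 2 ≤ n := by omega
  simpa only [P, B, tri3, Term.seq, mk_comp, place_mul, place_top hi', place_bot hi',
    place_par3 hi', place_par hi'', place_par hi''', mk_id, place_one, one_mul, mul_one,
    place_psStar_ite] using this

end EulerSteps

/-! ### Normal forms and reduction to them -/

namespace Circuit

open Set Real

variable {n k i j : ℕ}

theorem commute_P_P (hij : i < j) (hj : j < n) (φ ψ : ℝ) : Commute (P n i φ) (P n j ψ) :=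
  place_commute hij hj _ _

theorem commute_P_B (hij : i < j) (hj : j + 1 < n) (φ θ : ℝ) : Commute (P n i φ) (B n j θ) :=
  place_commute hij hj _ _

theorem commute_B_P (hij : i + 1 < j) (hj : j < n) (θ φ : ℝ) : Commute (B n i θ) (P n j φ) :=
  place_commute hij hj _ _

theorem commute_B_B (hij : i + 1 < j) (hj : j + 1 < n) (θ η : ℝ) :
    Commute (B n i θ) (B n j η) :=
  place_commute hij hj _ _

theorem commute_P_gen {g : Circuit n} (hg : g ∈ Gen n (k + 1)) (φ : ℝ) :
    Commute (P n k φ) g := by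
  induction hg using Submonoid.closure_induction with
  | mem x hx =>
    cases hx with
    | phase ψ h h' => exact commute_P_P h h' _ _
    | beam θ h h' => exact commute_P_B h h' _ _
  | one => exact Commute.one_right _
  | mul x y _ _ hx hy => exact hx.mul_right hy

theorem commute_Ps_gen {g : Circuit n} (hg : g ∈ Gen n (k + 1)) (φ : ℝ) :
    Commute (Ps n k φ) g := by
  rw [Ps]
  split_ifs
  · exact Commute.one_left _
  · exact commute_P_gen hg φ

theorem commute_B_gen {g : Circuit n} (hg : g ∈ Gen n (k + 2)) (θ : ℝ) :
    Commute (B n k θ) g := by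
  induction hg using Submonoid.closure_induction with
  | mem x hx =>
    cases hx with
    | phase ψ h h' => exact commute_B_P h h' _ _
    | beam θ h h' => exact commute_B_B h h' _ _
  | one => exact Commute.one_right _
  | mul x y _ _ hx hy => exact hx.mul_right hy

theorem IsGate.mono {g : Circuit n} (h : IsGate n j g) (hij : i ≤ j) : IsGate n i g := by
  cases h with
  | phase φ h h' => exact .phase φ (hij.trans h) h'
  | beam φ h h' => exact .beam φ (hij.trans h) h'

theorem IsGate.mem_gen {g : Circuit n} (h : IsGate n k g) : g ∈ Gen n k :=
  Submonoid.subset_closure h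

theorem gen_mono (h : i ≤ j) : Gen n j ≤ Gen n i :=
  Submonoid.closure_mono fun _ hg => IsGate.mono hg h

theorem Ps_mem_gen (hk : k ≤ i) (hi : i < n) (φ : ℝ) : Ps n i φ ∈ Gen n k := by
  rw [Ps]
  split_ifs
  · exact one_mem _
  · exact (IsGate.phase φ hk hi).mem_gen

/-- Runs of beam splitters, from some pair of wires up to the wires `k` and `k + 1`, each with a
phase shifter on its top left. -/
inductive IsRun (n : ℕ) : ℕ → Circuit n → Prop
  | one (k : ℕ) : IsRun n k 1
  | snoc {k : ℕ} {d : Circuit n} {α β : ℝ} : IsRun n (k + 1) d → k + 1 < n → α ∈ Ioo 0 π →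
      β ∈ Ico 0 π → (α = π / 2 → β = 0) → IsRun n k (d * (Ps n k β * B n k α))

/-- Normal forms on the wires `k, k + 1, …, n - 1`. -/
inductive IsNF (n : ℕ) : ℕ → Circuit n → Prop
  | nil : IsNF n n 1
  | cons {k : ℕ} {d x : Circuit n} {γ : ℝ} : k < n → IsRun n k d → γ ∈ Ico 0 (2 * π) →
      IsNF n (k + 1) x → IsNF n k (d * (Ps n k γ * x))

theorem IsRun.mem_gen {d : Circuit n} (h : IsRun n k d) : d ∈ Gen n k := by
  induction h with
  | one k => exact one_mem _
  | @snoc k d α β _ hk _ _ _ ih =>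
    exact mul_mem (gen_mono (Nat.le_succ k) ih)
      (mul_mem (Ps_mem_gen le_rfl (by omega) β) (IsGate.beam α le_rfl hk).mem_gen)

/-- Circuits made of phase shifters on wire `k` and of gates on the wires `k + 1, k + 2, …`. -/
def Res (n k : ℕ) : Submonoid (Circuit n) :=
  Submonoid.closure {g | (k < n ∧ ∃ φ, g = P n k φ) ∨ IsGate n (k + 1) g}

theorem gen_le_res : Gen n (k + 1) ≤ Res n k :=
  Submonoid.closure_mono fun _ h => Or.inr h

theorem P_mem_res (hi : i < n) (h : k ≤ i) (φ : ℝ) : P n i φ ∈ Res n k := by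
  rcases h.eq_or_lt with rfl | h
  · exact Submonoid.subset_closure (.inl ⟨hi, φ, rfl⟩)
  · exact gen_le_res (IsGate.phase φ h hi).mem_gen

theorem B_mem_res (hi : i + 1 < n) (h : k < i) (θ : ℝ) : B n i θ ∈ Res n k :=
  gen_le_res (IsGate.beam θ h hi).mem_gen

/-- The circuit reduces to a single cell of a run, followed by a residual circuit. -/
def CellForm (n k : ℕ) (a : Circuit n) : Prop :=
  ∃ α β : ℝ, ∃ w ∈ Res n k, α ∈ Ioo 0 π ∧ β ∈ Ico 0 π ∧ (α = π / 2 → β = 0) ∧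
    Steps n a (Ps n k β * B n k α * w)

/-- The circuit reduces to a run followed by a residual circuit. -/
def RunForm (n k : ℕ) (a : Circuit n) : Prop :=
  ∃ d w, IsRun n k d ∧ w ∈ Res n k ∧ Steps n a (d * w)

theorem CellForm.of_steps {a b : Circuit n} (h : Steps n a b) (hb : CellForm n k b) :
    CellForm n k a := by
  obtain ⟨α, β, w, hw, hα, hβ, h0, hs⟩ := hb
  exact ⟨α, β, w, hw, hα, hβ, h0, h.trans hs⟩

theorem CellForm.mul_res {a w : Circuit n} (ha : CellForm n k a) (hw : w ∈ Res n k) :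
    CellForm n k (a * w) := by
  obtain ⟨α, β, w', hw', hα, hβ, h0, hs⟩ := ha
  refine ⟨α, β, w' * w, mul_mem hw' hw, hα, hβ, h0, ?_⟩
  rw [← mul_assoc]
  exact hs.mul_right w

theorem RunForm.of_steps {a b : Circuit n} (h : Steps n a b) (hb : RunForm n k b) :
    RunForm n k a := by
  obtain ⟨d, w, hd, hw, hs⟩ := hb
  exact ⟨d, w, hd, hw, h.trans hs⟩

theorem RunForm.mul_res {a w : Circuit n} (ha : RunForm n k a) (hw : w ∈ Res n k) :
    RunForm n k (a * w) := by
  obtain ⟨d, w', hd, hw', hs⟩ := ha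
  refine ⟨d, w' * w, hd, mul_mem hw' hw, ?_⟩
  rw [← mul_assoc]
  exact hs.mul_right w

theorem RunForm.of_res {w : Circuit n} (hw : w ∈ Res n k) : RunForm n k w :=
  ⟨1, w, .one k, hw, by rw [one_mul]⟩

theorem CellForm.run_mul {a d : Circuit n} (hk : k + 1 < n) (hd : IsRun n (k + 1) d)
    (ha : CellForm n k a) : RunForm n k (d * a) := by
  obtain ⟨α, β, w, hw, hα, hβ, h0, hs⟩ := ha
  refine ⟨_, w, hd.snoc hk hα hβ h0, hw, ?_⟩
  rw [mul_assoc]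
  exact hs.mul_left d

/-- The phase is brought into the range allowed in a cell. At `α = π / 2` it crosses to the bottom
wire (rule 7); otherwise an excess of `π` is moved behind the beam splitter (rule 8). -/
theorem cellForm_Ps_mul_B (hk : k + 1 < n) {α β : ℝ} (hα : α ∈ Ioo 0 π)
    (hβ : β ∈ Ico 0 (2 * π)) : CellForm n k (Ps n k β * B n k α) := by
  by_cases h0 : β = 0
  · exact ⟨α, β, 1, one_mem _, hα, ⟨h0.ge, h0 ▸ pi_pos⟩, fun _ => h0, by rw [mul_one]⟩
  have hPs : Ps n k β = P n k β := if_neg h0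
  by_cases h1 : α = π / 2
  · refine ⟨π / 2, 0, P n (k + 1) β, P_mem_res hk (Nat.le_succ k) β, h1 ▸ hα, ⟨le_rfl, pi_pos⟩,
      fun _ => rfl, ?_⟩
    rw [hPs, h1, Ps, if_pos rfl, one_mul]
    exact steps_pi_div_two hk ⟨lt_of_le_of_ne hβ.1 (Ne.symm h0), hβ.2⟩
  by_cases h2 : β < π
  · exact ⟨α, β, 1, one_mem _, hα, ⟨hβ.1, h2⟩, fun h => absurd h h1, by rw [mul_one]⟩
  refine ⟨π - α, β - π, P n (k + 1) π, P_mem_res hk (Nat.le_succ k) π,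
    ⟨by linarith [hα.2], by linarith [hα.1]⟩, ⟨by linarith, by linarith [hβ.2]⟩,
    fun h => absurd (by linarith) h1, ?_⟩
  rw [hPs, mul_assoc]
  exact (steps_top_phase hk ⟨by linarith, hβ.2⟩ hα h1).trans
    ((steps_P_Ps (by omega) ⟨by linarith, by linarith [hβ.2, pi_pos]⟩).mul_right _)

theorem CellForm.P_mul {a : Circuit n} (hk : k + 1 < n) (φ : ℝ) (ha : CellForm n k a) :
    CellForm n k (P n k φ * a) := by
  obtain ⟨α, β, w, hw, hα, hβ, h0, hs⟩ := ha
  obtain ⟨χ, hχ, hs'⟩ := exists_steps_P_mul_Ps (n := n) (i := k) (by omega) φ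
    ⟨hβ.1, by linarith [hβ.2, pi_pos]⟩
  refine .of_steps ((hs.mul_left _).trans ?_) ((cellForm_Ps_mul_B hk hα hχ).mul_res hw)
  rw [← mul_assoc, ← mul_assoc]
  exact (hs'.mul_right _).mul_right _

/-- Rule 6 trades the phase on the bottom wire for its opposite on the top wire, which fuses with
the phase of the cell, and two phases behind the beam splitter, which join the residue. -/
theorem CellForm.succ_P_mul {a : Circuit n} (hk : k + 1 < n) (φ : ℝ) (ha : CellForm n k a) :
    CellForm n k (P n (k + 1) φ * a) := by
  obtain ⟨ψ, hψ, hs⟩ := exists_steps_P hk φ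
  refine .of_steps (hs.mul_right a) ?_
  by_cases h : ψ = 0
  · rwa [Ps, if_pos h, one_mul]
  obtain ⟨α, β, w, hw, hα, hβ, h0, ha⟩ := ha
  have hβ' : β ∈ Ico 0 (2 * π) := ⟨hβ.1, by linarith [hβ.2, pi_pos]⟩
  refine .of_steps (ha.mul_left _) ?_
  have hc := (commute_Ps_gen (n := n) (Ps_mem_gen le_rfl hk ψ) β).symm.eq
  obtain ⟨χ, hχ, hs⟩ := exists_steps_P (n := n) (i := k) (by omega) (-ψ)
  obtain ⟨ω, hω, hs'⟩ := exists_steps_Ps_mul_Ps (n := n) (i := k) (by omega) hβ' hχ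
  have hPs : Ps n (k + 1) ψ = P n (k + 1) ψ := if_neg h
  have := steps_bottom_phase hk ⟨lt_of_le_of_ne hψ.1 (Ne.symm h), hψ.2⟩ hα
  rw [← hPs] at this
  rw [← mul_assoc, ← mul_assoc, hc, mul_assoc (Ps n k β)]
  refine CellForm.mul_res (.of_steps ((this.mul_left _).trans ((hs.mul_right _).mul_left _)) ?_) hw
  rw [← mul_assoc]
  refine .of_steps (hs'.mul_right _) ?_
  rw [← mul_assoc]
  refine (cellForm_Ps_mul_B hk hα hω).mul_res (mul_mem (P_mem_res (by omega) le_rfl _) ?_)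
  rw [hPs]
  exact P_mem_res hk (Nat.le_succ k) ψ

/-- The residue of a run ending at `k + 1` passes the next cell: phases on wire `k + 1` hit its
bottom input, while gates from wire `k + 2` on commute with it. -/
theorem CellForm.res_mul {a w : Circuit n} (hk : k + 1 < n) (hw : w ∈ Res n (k + 1))
    (ha : CellForm n k a) : CellForm n k (w * a) := by
  induction hw using Submonoid.closure_induction generalizing a with
  | mem g hg =>
    rcases hg with ⟨-, φ, rfl⟩ | hg
    · exact ha.succ_P_mul hk φ
    · obtain ⟨α, β, w, hw, hα, hβ, h0, ha⟩ := ha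
      have hg1 : g ∈ Gen n (k + 1) := (hg.mono (Nat.le_succ _)).mem_gen
      refine ⟨α, β, g * w, mul_mem (gen_le_res hg1) hw, hα, hβ, h0, ?_⟩
      have h1 := (commute_Ps_gen hg1 β).mul_left (commute_B_gen hg.mem_gen α)
      rw [← mul_assoc, h1.eq, mul_assoc]
      exact ha.mul_left g
  | one => rwa [one_mul]
  | mul x y _ _ hx hy => rw [mul_assoc]; exact hx (hy ha)

theorem RunForm.mul_cell {a b : Circuit n} (hk : k + 1 < n) (ha : RunForm n (k + 1) a)
    (hb : CellForm n k b) : RunForm n k (a * b) := by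
  obtain ⟨d, w, hd, hw, hs⟩ := ha
  refine .of_steps (hs.mul_right b) ?_
  rw [mul_assoc]
  exact (hb.res_mul hk hw).run_mul hk hd

theorem cellForm_cell {α β : ℝ} (hα : α ∈ Ioo 0 π) (hβ : β ∈ Ico 0 π)
    (h0 : α = π / 2 → β = 0) : CellForm n k (Ps n k β * B n k α) :=
  ⟨α, β, 1, one_mem _, hα, hβ, h0, by rw [mul_one]⟩

/-- A phase on wire `k` commutes with everything before the last cell and is merged into that cell.
A lower phase is first pushed through the shorter run, and the resulting residue then passes the
last cell. -/
theorem IsRun.runForm_P_mul {d : Circuit n} (hd : IsRun n k d) (φ : ℝ) (hki : k ≤ i)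
    (hi : i < n) : RunForm n k (P n i φ * d) := by
  induction hd with
  | one k =>
    rw [mul_one]
    exact .of_res (P_mem_res hi hki φ)
  | @snoc k d α β hd hk hα hβ h0 ih =>
    rcases hki.eq_or_lt with rfl | hki
    · rw [← mul_assoc, (commute_P_gen hd.mem_gen φ).eq, mul_assoc]
      exact ((cellForm_cell hα hβ h0).P_mul hk φ).run_mul hk hd
    · rw [← mul_assoc]
      exact (ih hki).mul_cell hk (cellForm_cell hα hβ h0)

theorem runForm_of_canonical2 (hk : k + 1 < n) {α₁ β₁ β₂ β₃ : ℝ}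
    (h : Canonical2 α₁ β₁ β₂ β₃) :
    RunForm n k (P n k β₁ * (B n k α₁ * (P n k β₂ * P n (k + 1) β₃))) := by
  obtain ⟨hα, hβ, -, -, h0⟩ := h
  have hw : P n k β₂ * P n (k + 1) β₃ ∈ Res n k :=
    mul_mem (P_mem_res (by omega) le_rfl _) (P_mem_res hk (Nat.le_succ k) _)
  have hP := steps_P_Ps (n := n) (i := k) (by omega) ⟨hβ.1, by linarith [hβ.2, pi_pos]⟩
  rw [← mul_assoc]
  refine RunForm.mul_res (.of_steps (hP.mul_right _) ?_) hw
  by_cases h1 : α₁ = 0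
  · rw [h0 (.inl h1), Ps, if_pos rfl, one_mul, h1]
    exact .of_steps (steps_B_zero hk) (.of_res (one_mem _))
  · have hα' : α₁ ∈ Ioo 0 π := ⟨lt_of_le_of_ne hα.1 (Ne.symm h1), hα.2⟩
    have := (cellForm_cell (n := n) (k := k) hα' hβ (fun h => h0 (.inr h))).run_mul hk (.one _)
    rwa [one_mul] at this

/-- The first two cells of the triangle prolong the run `d` as far as their angles are nonzero; the
third cell and the final phases avoid beam splitters on wire `k` and form the residue. -/
theorem runForm_of_canonical3 (hk : k + 2 < n) {d : Circuit n} (hd : IsRun n (k + 2) d)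
    {α₁ α₂ α₃ β₁ β₂ β₃ β₄ β₅ β₆ : ℝ} (h : Canonical3 α₁ α₂ α₃ β₁ β₂ β₃ β₄ β₅ β₆) :
    RunForm n k (d * (P n (k + 1) β₁ * (B n (k + 1) α₁ * (P n k β₂ * (B n k α₂ *
      (P n (k + 1) β₃ * (B n (k + 1) α₃ *
        (P n k β₄ * (P n (k + 1) β₅ * P n (k + 2) β₆))))))))) := by
  obtain ⟨hα₁, hα₂, -, hβ₁, hβ₂, -, -, -, -, h01, h02, -, h21⟩ := h
  have hw : P n (k + 1) β₃ * (B n (k + 1) α₃ *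
      (P n k β₄ * (P n (k + 1) β₅ * P n (k + 2) β₆))) ∈ Res n k :=
    mul_mem (P_mem_res (by omega) (by omega) _) (mul_mem (B_mem_res hk (by omega) _)
      (mul_mem (P_mem_res (by omega) le_rfl _)
        (mul_mem (P_mem_res (by omega) (by omega) _) (P_mem_res (by omega) (by omega) _))))
  generalize P n (k + 1) β₃ * (B n (k + 1) α₃ *
      (P n k β₄ * (P n (k + 1) β₅ * P n (k + 2) β₆))) = w at hw ⊢
  have hP₁ := steps_P_Ps (n := n) (i := k + 1) (by omega) ⟨hβ₁.1, by linarith [hβ₁.2, pi_pos]⟩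
  have hP₂ := steps_P_Ps (n := n) (i := k) (by omega) ⟨hβ₂.1, by linarith [hβ₂.2, pi_pos]⟩
  have hs : Steps n
      (d * (P n (k + 1) β₁ * (B n (k + 1) α₁ * (P n k β₂ * (B n k α₂ * w)))))
      (d * (Ps n (k + 1) β₁ * B n (k + 1) α₁) * (Ps n k β₂ * B n k α₂) * w) := by
    simp only [mul_assoc]
    exact (hP₁.mul ((hP₂.mul .refl).mul_left _)).mul_left d
  refine .of_steps hs (RunForm.mul_res ?_ hw)
  have hdres : d ∈ Res n k := gen_le_res (gen_mono (Nat.le_succ _) hd.mem_gen)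
  have hk' : k + 1 < n := by omega
  have h1 : RunForm n k (d * (Ps n k β₂ * B n k α₂)) := by
    by_cases h2 : α₂ = 0
    · rw [h02 (.inl h2), Ps, if_pos rfl, one_mul, h2]
      refine .of_steps ((steps_B_zero hk').mul_left d) ?_
      rw [mul_one]
      exact .of_res hdres
    · have hα' : α₂ ∈ Ioo 0 π := ⟨lt_of_le_of_ne hα₂.1 (Ne.symm h2), hα₂.2⟩
      -- Here `d` lives on the wires from `k + 2` on, so the cell on wire `k` moves in front of it
      -- and is a run by itself, with `d` as residue.
      rw [← ((commute_Ps_gen (gen_mono (Nat.le_succ _) hd.mem_gen) β₂).mul_left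
        (commute_B_gen hd.mem_gen α₂)).eq, ← one_mul (Ps n k β₂ * B n k α₂)]
      exact ((cellForm_cell hα' hβ₂ fun h => h02 (.inr h)).run_mul hk' (.one _)).mul_res hdres
  by_cases h3 : α₁ = 0
  · rw [h01 (.inl h3), Ps, if_pos rfl, one_mul, h3]
    refine .of_steps (((steps_B_zero hk).mul_left d).mul_right _) ?_
    rwa [mul_one]
  -- By the last canonicity condition both cells are present, so they extend `d` without a gap.
  · have h2 : α₂ ≠ 0 := fun h => h3 (h21 h)
    have hα₁' : α₁ ∈ Ioo 0 π := ⟨lt_of_le_of_ne hα₁.1 (Ne.symm h3), hα₁.2⟩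
    have hα₂' : α₂ ∈ Ioo 0 π := ⟨lt_of_le_of_ne hα₂.1 (Ne.symm h2), hα₂.2⟩
    exact (cellForm_cell hα₂' hβ₂ fun h => h02 (.inr h)).run_mul hk'
      (hd.snoc hk hα₁' hβ₁ fun h => h01 (.inr h))

/-- A beam splitter below wire `k` is handled by recursion. On the wires `k`, `k + 1` it faces
either a run of one cell, where the two-wire Euler rule applies, or at least two cells, where the
three-wire rule applies to the last two. -/
theorem IsRun.runForm_B_mul {d : Circuit n} (hd : IsRun n k d) {θ : ℝ} (hθ : θ ∈ Ioo 0 π)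
    (hki : k ≤ i) (hi : i + 1 < n) : RunForm n k (B n i θ * d) := by
  induction hd with
  | one k =>
    rw [mul_one]
    rcases hki.eq_or_lt with rfl | hki
    · have := (cellForm_cell (n := n) (k := k) hθ ⟨le_rfl, pi_pos⟩ fun _ => rfl).run_mul hi (.one _)
      rwa [one_mul, Ps, if_pos rfl, one_mul] at this
    · exact .of_res (B_mem_res hi hki θ)
  | @snoc k d α β hd hk hα hβ h0 ih =>
    have hβ' : β ∈ Ico 0 (2 * π) := ⟨hβ.1, by linarith [hβ.2, pi_pos]⟩
    rcases hki.eq_or_lt with rfl | hki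
    · cases hd with
      | one =>
        obtain ⟨α₁, β₁, β₂, β₃, hc, hs⟩ := exists_steps_euler2 hk hθ hα hβ'
        rw [one_mul]
        exact .of_steps hs (runForm_of_canonical2 hk hc)
      | @snoc _ d α' η hd hk' hα' hη h0' =>
        obtain ⟨α₁, α₂, α₃, β₁, β₂, β₃, β₄, β₅, β₆, hc, hs⟩ := exists_steps_euler3 hk' hθ hα' hα
          ⟨hη.1, by linarith [hη.2, pi_pos]⟩ hβ'
        -- The beam splitter skips `d`, which starts at wire `k + 2`, and the phase `β` on wire `k`
        -- skips the cell on wire `k + 1`. This exposes the left-hand side of rule 10.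
        have e : B n k θ * (d * (Ps n (k + 1) η * B n (k + 1) α') * (Ps n k β * B n k α)) =
            d * (B n k θ * (Ps n k β * Ps n (k + 1) η * (B n (k + 1) α' * B n k α))) := by
          have h1 := (commute_B_gen hd.mem_gen θ).eq
          have h2 := (commute_Ps_gen (n := n) (Ps_mem_gen le_rfl hk η) β).eq
          have h3 := (commute_Ps_gen (n := n) (IsGate.beam α' le_rfl hk').mem_gen β).eq
          calc _ = (B n k θ * d) * (Ps n (k + 1) η * ((B n (k + 1) α' * Ps n k β) * B n k α)) := by
                simp only [mul_assoc]
            _ = d * (B n k θ * ((Ps n (k + 1) η * Ps n k β) * (B n (k + 1) α' * B n k α))) := by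
                rw [h1, ← h3]; simp only [mul_assoc]
            _ = _ := by rw [← h2]
        rw [e]
        exact .of_steps (hs.mul_left d) (runForm_of_canonical3 hk' hd hc)
    · rw [← mul_assoc]
      exact (ih hki).mul_cell hk (cellForm_cell hα hβ h0)

/-- This treats a product of gates one factor at a time, as needed when a beam splitter sheds two
phases `π`. -/
theorem RunForm.trans {a b : Circuit n} (ha : ∀ d, IsRun n k d → RunForm n k (a * d))
    (hb : RunForm n k b) : RunForm n k (a * b) := by
  obtain ⟨d, w, hd, hw, hs⟩ := hb
  refine .of_steps (hs.mul_left a) ?_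
  rw [← mul_assoc]
  exact (ha d hd).mul_res hw

theorem IsRun.runForm_gate_mul {d g : Circuit n} (hd : IsRun n k d) (hg : IsGate n k g) :
    RunForm n k (g * d) := by
  cases hg with
  | phase φ h h' => exact hd.runForm_P_mul φ h h'
  | @beam i θ h h' =>
    obtain ⟨θ', hθ', hs⟩ := exists_steps_B h' θ
    have hB (d : Circuit n) (hd : IsRun n k d) : RunForm n k (B n i θ' * d) := by
      by_cases h0 : θ' = 0
      · rw [h0]
        refine .of_steps ((steps_B_zero h').mul_right d) ?_
        rw [one_mul]
        exact ⟨d, 1, hd, one_mem _, by rw [mul_one]⟩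
      · exact hd.runForm_B_mul ⟨lt_of_le_of_ne hθ'.1 (Ne.symm h0), hθ'.2⟩ h h'
    rcases hs with hs | hs
    · exact .of_steps (hs.mul_right d) (hB d hd)
    · refine .of_steps (hs.mul_right d) ?_
      rw [mul_assoc, mul_assoc]
      exact .trans hB (.trans (fun d hd => hd.runForm_P_mul π h (by omega))
        (hd.runForm_P_mul π (by omega) h'))

theorem isNF_one (h : k ≤ n) : IsNF n k 1 := by
  induction h using Nat.decreasingInduction with
  | self => exact .nil
  | of_succ k hk ih =>
    have := IsNF.cons (γ := 0) hk (.one k) ⟨le_rfl, two_pi_pos⟩ ih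
    rwa [one_mul, mul_one, Ps, if_pos rfl] at this

/-- The recursion goes up from the bottom wire: the residue left by the run at `k` acts on the part
handled at `k + 1`. -/
theorem exists_isNF_gen_mul (hk : k ≤ n) {g x : Circuit n} (hg : g ∈ Gen n k)
    (hx : IsNF n k x) : ∃ y, IsNF n k y ∧ Steps n (g * x) y := by
  induction hk using Nat.decreasingInduction generalizing g x with
  | self =>
    induction hg using Submonoid.closure_induction generalizing x with
    | mem g hg => cases hg <;> omega
    | one => exact ⟨x, hx, by rw [one_mul]⟩
    | mul a b _ _ ha hb =>
      obtain ⟨y, hy, hs⟩ := hb hx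
      obtain ⟨z, hz, hs'⟩ := ha hy
      exact ⟨z, hz, by rw [mul_assoc]; exact (hs.mul_left a).trans hs'⟩
  | of_succ k hk ih =>
    -- Absorption of a residue: phases on wire `k` fuse with `γ`, while gates below wire `k` commute
    -- with it and are absorbed by the induction hypothesis.
    have key {w : Circuit n} (hw : w ∈ Res n k) {γ : ℝ} (hγ : γ ∈ Ico 0 (2 * π)) {x : Circuit n}
        (hx : IsNF n (k + 1) x) : ∃ γ' ∈ Ico 0 (2 * π), ∃ y, IsNF n (k + 1) y ∧
          Steps n (w * (Ps n k γ * x)) (Ps n k γ' * y) := by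
      induction hw using Submonoid.closure_induction generalizing γ x with
      | mem g hg =>
        rcases hg with ⟨-, φ, rfl⟩ | hg
        · obtain ⟨γ', hγ', hs⟩ := exists_steps_P_mul_Ps hk φ hγ
          exact ⟨γ', hγ', x, hx, by rw [← mul_assoc]; exact hs.mul_right x⟩
        · obtain ⟨y, hy, hs⟩ := ih hg.mem_gen hx
          refine ⟨γ, hγ, y, hy, ?_⟩
          rw [← mul_assoc, ← (commute_Ps_gen hg.mem_gen γ).eq, mul_assoc]
          exact hs.mul_left _
      | one => exact ⟨γ, hγ, x, hx, by rw [one_mul]⟩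
      | mul a b _ _ ha hb =>
        obtain ⟨γ', hγ', y, hy, hs⟩ := hb hγ hx
        obtain ⟨γ'', hγ'', z, hz, hs'⟩ := ha hγ' hy
        exact ⟨γ'', hγ'', z, hz, by rw [mul_assoc]; exact (hs.mul_left a).trans hs'⟩
    induction hg using Submonoid.closure_induction generalizing x with
    | mem g hg =>
      cases hx with
      | nil => omega
      | @cons _ d x γ _ hd hγ hx =>
        obtain ⟨d', w, hd', hw, hs⟩ := hd.runForm_gate_mul hg
        obtain ⟨γ', hγ', y, hy, hs'⟩ := key hw hγ hx
        refine ⟨_, .cons hk hd' hγ' hy, ?_⟩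
        rw [← mul_assoc]
        refine (hs.mul_right _).trans ?_
        rw [mul_assoc]
        exact hs'.mul_left d'
    | one => exact ⟨x, hx, by rw [one_mul]⟩
    | mul a b _ _ ha hb =>
      obtain ⟨y, hy, hs⟩ := hb hx
      obtain ⟨z, hz, hs'⟩ := ha hy
      exact ⟨z, hz, by rw [mul_assoc]; exact (hs.mul_left a).trans hs'⟩

theorem exists_isNF (c : Circuit n) : ∃ y, IsNF n 0 y ∧ Steps n c y := by
  have := exists_isNF_gen_mul (Nat.zero_le n) (mem_gen_zero c) (isNF_one (Nat.zero_le n))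
  rwa [mul_one] at this

end Circuit

/-! ### A normal form is determined by its matrix -/

namespace Circuit

/-- The matrix of a circuit. -/
noncomputable def csem {n : ℕ} : Circuit n → Matrix (Fin n) (Fin n) ℂ :=
  Quotient.lift Term.sem fun _ _ h => sem_eq_of_proEq h

theorem csem_mk {n : ℕ} (t : Term n) : csem (mk t) = sem t := rfl

theorem csem_mul {n : ℕ} (a b : Circuit n) : csem (a * b) = csem b * csem a := by
  induction a, b using Quotient.inductionOn₂
  rfl

theorem csem_one (n : ℕ) : csem (1 : Circuit n) = 1 := rfl

theorem csem_mul_conjTranspose {n : ℕ} (a : Circuit n) : csem a * (csem a)ᴴ = 1 := by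
  induction a using Quotient.inductionOn
  exact sem_mul_conjTranspose _

theorem csem_tensor_congr {n m : ℕ} {a a' : Circuit n} {b b' : Circuit m}
    (h : csem a = csem a') (h' : csem b = csem b') :
    csem (a.tensor b) = csem (a'.tensor b') := by
  induction a, a' using Quotient.inductionOn₂
  induction b, b' using Quotient.inductionOn₂
  exact sem_tensor_congr h h'

theorem ent_csem_tensor {n m : ℕ} (f : Circuit n) (g : Circuit m) (a b : ℕ) :
    ent (csem (f.tensor g)) a b =
      if a < n ∧ b < n then ent (csem f) a b
      else if n ≤ a ∧ n ≤ b then ent (csem g) (a - n) (b - n) else 0 := by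
  induction f using Quotient.inductionOn
  induction g using Quotient.inductionOn
  exact ent_sem_tensor _ _ _ _

theorem ent_csem_place {n k i : ℕ} (h : i + k ≤ n) (c : Circuit k) (a b : ℕ) :
    ent (csem (place n i c)) a b =
      if i ≤ a ∧ a < i + k ∧ i ≤ b ∧ b < i + k then ent (csem c) (a - i) (b - i)
      else if a < n ∧ a = b then 1 else 0 := by
  obtain ⟨r, rfl⟩ := Nat.exists_eq_add_of_le h
  simp only [place_add, ent_csem_tensor, csem_one, ent_one]
  split_ifs <;> first | rfl | omega

end Circuit

open Circuit

theorem Step.csem_eq {Θ Φ : Set ℝ} {n : ℕ} {a b : Circuit n} (h : Step Θ Φ a b) :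
    csem a = csem b := by
  induction h with
  | rule h => exact sem_eq_of_rule h
  | @comp_left _ C C' D _ ih =>
    change csem (C * D) = csem (C' * D)
    rw [csem_mul, csem_mul, ih]
  | @comp_right _ C D D' _ ih =>
    change csem (C * D) = csem (C * D')
    rw [csem_mul, csem_mul, ih]
  | tensor_left D _ ih => exact csem_tensor_congr ih rfl
  | tensor_right C _ ih => exact csem_tensor_congr rfl ih

theorem csem_eq_of_reflTransGen {Θ Φ : Set ℝ} {n : ℕ} {a b : Circuit n}
    (h : Relation.ReflTransGen (Step Θ Φ) a b) : csem a = csem b := by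
  induction h with
  | refl => rfl
  | tail _ h ih => exact ih.trans h.csem_eq

theorem ent_mul {n : ℕ} (M N : Matrix (Fin n) (Fin n) ℂ) (a b : ℕ) :
    ent (M * N) a b = ∑ j ∈ Finset.range n, ent M a j * ent N j b := by
  by_cases h : a < n ∧ b < n
  · rw [Finset.sum_range]
    simp [ent, h, Matrix.mul_apply]
  · rw [ent_eq_zero _ h]
    symm
    refine Finset.sum_eq_zero fun j _ => ?_
    rcases not_and_or.1 h with h | h
    · rw [ent_eq_zero M fun h' => h h'.1, zero_mul]
    · rw [ent_eq_zero N fun h' => h h'.2, mul_zero]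

theorem ent_mul_of_row {n : ℕ} {M N : Matrix (Fin n) (Fin n) ℂ} {a k : ℕ} (hk : k < n)
    (h : ∀ j, j ≠ k → ent M a j = 0) (b : ℕ) : ent (M * N) a b = ent M a k * ent N k b := by
  rw [ent_mul, Finset.sum_eq_single k]
  · intro j _ hj
    rw [h j hj, zero_mul]
  · exact fun h => absurd (Finset.mem_range.2 hk) h

theorem ent_mul_of_col {n : ℕ} {M N : Matrix (Fin n) (Fin n) ℂ} {b k : ℕ} (hk : k < n)
    (h : ∀ j, j ≠ k → ent N j b = 0) (a : ℕ) : ent (M * N) a b = ent M a k * ent N k b := by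
  rw [ent_mul, Finset.sum_eq_single k]
  · intro j _ hj
    rw [h j hj, mul_zero]
  · exact fun h => absurd (Finset.mem_range.2 hk) h

theorem ent_mul_of_row_pair {n : ℕ} {M N : Matrix (Fin n) (Fin n) ℂ} {a k : ℕ} (hk : k + 1 < n)
    (h : ∀ j, j ≠ k → j ≠ k + 1 → ent M a j = 0) (b : ℕ) :
    ent (M * N) a b = ent M a k * ent N k b + ent M a (k + 1) * ent N (k + 1) b := by
  rw [ent_mul, Finset.sum_eq_add k (k + 1) (by omega)]
  · intro j _ hj
    rw [h j hj.1 hj.2, zero_mul]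
  · exact fun h => absurd (Finset.mem_range.2 (by omega)) h
  · exact fun h => absurd (Finset.mem_range.2 hk) h

namespace Circuit

open Set Real

variable {n k : ℕ}

/-- Wire `k` is untouched, so row and column `k` are those of the identity. -/
theorem ent_csem_gen {g : Circuit n} (hg : g ∈ Gen n (k + 1)) (hk : k < n) (a : ℕ) :
    ent (csem g) k a = (if a = k then 1 else 0) ∧ ent (csem g) a k = (if a = k then 1 else 0) := by
  induction hg using Submonoid.closure_induction generalizing a with
  | mem g hg =>
    cases hg with
    | phase φ h h' =>
      rw [P, ent_csem_place h', ent_csem_place h']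
      constructor <;> split_ifs <;> first | rfl | omega
    | beam φ h h' =>
      rw [B, ent_csem_place h', ent_csem_place h']
      constructor <;> split_ifs <;> first | rfl | omega
  | one =>
    rw [csem_one, ent_one, ent_one]
    constructor <;> split_ifs <;> first | rfl | omega
  | mul x y _ _ hx hy =>
    rw [csem_mul, ent_mul_of_row hk fun j hj => by rw [(hy j).1, if_neg hj],
      ent_mul_of_col hk fun j hj => by rw [(hx j).2, if_neg hj], (hy k).1, (hx k).2, if_pos rfl,
      one_mul, mul_one]
    exact ⟨(hx a).1, (hy a).2⟩

theorem ent_csem_Ps (hk : k < n) (β : ℝ) (a b : ℕ) :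
    ent (csem (Ps n k β)) a b = if a < n ∧ a = b then
      (if a = k then Complex.exp (β * Complex.I) else 1) else 0 := by
  have hP : ent (csem (P n k β)) a b = if a < n ∧ a = b then
      (if a = k then Complex.exp (β * Complex.I) else 1) else 0 := by
    rw [P, ent_csem_place hk]
    by_cases h : k ≤ a ∧ a < k + 1 ∧ k ≤ b ∧ b < k + 1
    · obtain rfl : a = k := by omega
      obtain rfl : b = a := by omega
      simp [ent, csem_mk, sem, hk]
    · rw [if_neg h]
      split_ifs <;> first | rfl | omega
  rw [Ps]
  by_cases h0 : β = 0
  · rw [if_pos h0, csem_one, ent_one, h0]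
    simp only [Complex.ofReal_zero, zero_mul, Complex.exp_zero, ite_self]
    split_ifs <;> first | rfl | omega
  · rw [if_neg h0, hP]

theorem ent_csem_B (hk : k + 1 < n) (α : ℝ) (b : ℕ) :
    ent (csem (B n k α)) k b = if b = k then (Real.cos α : ℂ) else
      if b = k + 1 then Complex.I * (Real.sin α : ℂ) else 0 := by
  rw [B, ent_csem_place hk]
  by_cases h : b = k
  · simp [ent, csem_mk, sem, h]
  by_cases h' : b = k + 1
  · simp [ent, csem_mk, sem, h']
  · rw [if_neg (by omega), if_neg (by omega), if_neg h, if_neg h']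

/-- This is the recursion for first rows of runs: as `d` avoids wire `k`, the cell mixes a unit
vector with row `k + 1` of `d`. -/
theorem ent_csem_cell (hk : k + 1 < n) {d : Circuit n} (hd : d ∈ Gen n (k + 1)) (α β : ℝ)
    (b : ℕ) :
    ent (csem (d * (Ps n k β * B n k α))) k b =
      if b = k then (Real.cos α : ℂ) * Complex.exp (β * Complex.I)
      else Complex.I * (Real.sin α : ℂ) * ent (csem d) (k + 1) b := by
  rw [csem_mul, csem_mul, Matrix.mul_assoc, ent_mul_of_row_pair hk (fun j h h' => by
    rw [ent_csem_B hk, if_neg h, if_neg h']),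
    ent_mul_of_row (a := k) (k := k) (by omega) (fun j h => by
      rw [ent_csem_Ps (by omega), if_neg (by omega)]),
    ent_mul_of_row (a := k + 1) (k := k + 1) hk (fun j h => by
      rw [ent_csem_Ps (by omega), if_neg (by omega)]),
    ent_csem_B hk, ent_csem_B hk, ent_csem_Ps (by omega), ent_csem_Ps (by omega),
    (ent_csem_gen hd (by omega) b).1]
  have hne : k + 1 ≠ k := by omega
  have hlt : k < n := by omega
  by_cases hb : b = k
  · rw [hb, (ent_csem_gen hd (by omega) (k + 1)).2]
    simp [hlt]
  · simp [hb, hk]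

theorem exists_ent_csem_ne_zero (c : Circuit n) (hk : k < n) : ∃ b, ent (csem c) k b ≠ 0 := by
  by_contra! h
  have := ent_mul (csem c) (csem c)ᴴ k k
  rw [csem_mul_conjTranspose, ent_one, if_pos ⟨hk, hk, rfl⟩,
    Finset.sum_eq_zero fun j _ => by rw [h, zero_mul]] at this
  exact one_ne_zero this

theorem exp_mul_I_injOn {β β' : ℝ} (h : β ∈ Ico 0 (2 * π)) (h' : β' ∈ Ico 0 (2 * π))
    (he : Complex.exp (β * Complex.I) = Complex.exp (β' * Complex.I)) : β = β' := by
  obtain ⟨m, hm⟩ := Complex.exp_eq_exp_iff_exists_int.1 he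
  have h1 : β = β' + m * (2 * π) := by
    have : (β : ℂ) * Complex.I = ((β' + m * (2 * π) : ℝ) : ℂ) * Complex.I := by
      rw [hm]; push_cast; ring
    exact_mod_cast mul_right_cancel₀ Complex.I_ne_zero this
  have h2 : (m : ℝ) < 1 := by
    by_contra! hc
    nlinarith [h.2, h'.1, pi_pos]
  have h3 : (-1 : ℝ) < m := by
    by_contra! hc
    nlinarith [h.1, h'.2, pi_pos]
  have h4 : m = 0 := by
    have h2' : m < 1 := by exact_mod_cast h2
    have h3' : -1 < m := by exact_mod_cast h3
    omega
  rw [h1, h4]; simp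

theorem euler_angles_unique {c c' : ℂ} {α β α' β' : ℝ} (hc : c ≠ 0) (hα : α ∈ Ioo 0 π)
    (hβ : β ∈ Ico 0 π) (h0 : α = π / 2 → β = 0) (hα' : α' ∈ Ioo 0 π)
    (hβ' : β' ∈ Ico 0 π) (h0' : α' = π / 2 → β' = 0)
    (hs : c * (Real.sin α : ℂ) = c' * (Real.sin α' : ℂ))
    (he : c * ((Real.cos α : ℂ) * Complex.exp (β * Complex.I)) =
      c' * ((Real.cos α' : ℂ) * Complex.exp (β' * Complex.I))) :
    α = α' ∧ β = β' ∧ c = c' := by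
  have hsin := Real.sin_pos_of_pos_of_lt_pi hα.1 hα.2
  have hsin' := Real.sin_pos_of_pos_of_lt_pi hα'.1 hα'.2
  have hcos {x : ℝ} (hx : x ∈ Ioo 0 π) (h : Real.cos x = 0) : x = π / 2 := by
    refine Real.injOn_cos ⟨hx.1.le, hx.2.le⟩ ⟨by positivity, by linarith [pi_pos]⟩ ?_
    rw [h, Real.cos_pi_div_two]
  -- Dividing the two equations eliminates the scalars and leaves `cot α · exp(i(β - β')) = cot α'`,
  -- here with denominators cleared. The right side is real.
  have key : ((Real.cos α * Real.sin α' : ℝ) : ℂ) * Complex.exp ((β - β' : ℝ) * Complex.I) =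
      ((Real.cos α' * Real.sin α : ℝ) : ℂ) := by
    have h1 : c * ((Real.cos α : ℂ) * (Real.sin α' : ℂ) * Complex.exp (β * Complex.I)) =
        c * ((Real.cos α' : ℂ) * (Real.sin α : ℂ) * Complex.exp (β' * Complex.I)) := by
      linear_combination (Real.sin α' : ℂ) * he -
        (Real.cos α' : ℂ) * Complex.exp (β' * Complex.I) * hs
    have h2 := mul_left_cancel₀ hc h1
    rw [Complex.ofReal_sub, sub_mul, Complex.exp_sub, ← mul_div_assoc,
      div_eq_iff (Complex.exp_ne_zero _), Complex.ofReal_mul, Complex.ofReal_mul]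
    exact h2
  have hre := congrArg Complex.re key
  have him := congrArg Complex.im key
  rw [Complex.re_ofReal_mul, Complex.exp_ofReal_mul_I_re, Complex.ofReal_re] at hre
  rw [Complex.im_ofReal_mul, Complex.exp_ofReal_mul_I_im, Complex.ofReal_im] at him
  have hαβ : α = α' ∧ β = β' := by
    -- Either both cosines vanish, so both angles are `π / 2` and the phases are `0` by convention,
    -- or `sin (β - β') = 0` with `|β - β'| < π`.
    rcases mul_eq_zero.1 him with h | h
    · rw [h, zero_mul] at hre
      have e := hcos hα ((mul_eq_zero.1 h).resolve_right hsin'.ne')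
      have e' := hcos hα' ((mul_eq_zero.1 hre.symm).resolve_right hsin.ne')
      exact ⟨e.trans e'.symm, (h0 e).trans (h0' e').symm⟩
    · have hβeq : β - β' = 0 := by
        refine (Real.sin_eq_zero_iff_of_lt_of_lt ?_ ?_).1 h
        · linarith [hβ.1, hβ'.2]
        · linarith [hβ.2, hβ'.1]
      rw [hβeq, Real.cos_zero, mul_one] at hre
      have : Real.sin (α' - α) = 0 := by rw [Real.sin_sub]; linarith
      have := (Real.sin_eq_zero_iff_of_lt_of_lt (by linarith [hα'.1, hα.2])
        (by linarith [hα'.2, hα.1])).1 this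
      exact ⟨by linarith, by linarith⟩
  obtain ⟨rfl, rfl⟩ := hαβ
  exact ⟨rfl, rfl, mul_right_cancel₀ (Complex.ofReal_ne_zero.2 hsin.ne') hs⟩

/-- This separates a nonempty run from the empty one, whose row vanishes off the diagonal. -/
theorem IsRun.row_snoc_ne {d : Circuit n} {α β : ℝ} (hd : IsRun n (k + 1) d)
    (hk : k + 1 < n) (hα : α ∈ Ioo 0 π) :
    ∃ b, b ≠ k ∧ ent (csem (d * (Ps n k β * B n k α))) k b ≠ 0 := by
  obtain ⟨b, hb⟩ := exists_ent_csem_ne_zero d hk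
  have hbk : b ≠ k := by
    rintro rfl
    exact hb (by rw [(ent_csem_gen hd.mem_gen (by omega) _).2, if_neg (by omega)])
  refine ⟨b, hbk, ?_⟩
  rw [ent_csem_cell hk hd.mem_gen, if_neg hbk]
  exact mul_ne_zero (mul_ne_zero Complex.I_ne_zero
    (Complex.ofReal_ne_zero.2 (Real.sin_pos_of_pos_of_lt_pi hα.1 hα.2).ne')) hb

/-- A run is determined by its first row, even up to a scalar. -/
theorem IsRun.eq_of_row {d d' : Circuit n} (hd : IsRun n k d) (hd' : IsRun n k d') (hk : k < n)
    {c c' : ℂ} (hc : c ≠ 0) (hc' : c' ≠ 0)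
    (h : ∀ b, c * ent (csem d) k b = c' * ent (csem d') k b) : d = d' ∧ c = c' := by
  have hone (b) (hb : b ≠ k) : ent (csem (1 : Circuit n)) k b = 0 := by
    rw [csem_one, ent_one, if_neg (by tauto)]
  induction hd generalizing d' c c' with
  | one k =>
    cases hd' with
    | one =>
      have := h k
      rw [csem_one, ent_one, if_pos ⟨hk, hk, rfl⟩] at this
      exact ⟨rfl, by simpa using this⟩
    | snoc hd' hk' hα hβ h0 =>
      obtain ⟨b, hb, hne⟩ := hd'.row_snoc_ne hk' hα
      have := h b
      rw [hone b hb, mul_zero] at this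
      exact absurd this.symm (mul_ne_zero hc' hne)
  | @snoc k d α β hd hk' hα hβ h0 ih =>
    cases hd' with
    | one =>
      obtain ⟨b, hb, hne⟩ := hd.row_snoc_ne hk' hα
      have := h b
      rw [hone b hb, mul_zero] at this
      exact absurd this (mul_ne_zero hc hne)
    | @snoc _ d' α' β' hd' _ hα' hβ' h0' =>
      have hsin := Real.sin_pos_of_pos_of_lt_pi hα.1 hα.2
      have hsin' := Real.sin_pos_of_pos_of_lt_pi hα'.1 hα'.2
      -- Off entry `k` the rows are those of the shorter runs, scaled by the still unknown sines.
      -- This is why the statement carries scalars; entry `k` then yields the angles.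
      obtain ⟨rfl, hs⟩ := ih (c := c * (Real.sin α : ℂ)) (c' := c' * (Real.sin α' : ℂ)) hd' hk'
        (mul_ne_zero hc (Complex.ofReal_ne_zero.2 hsin.ne'))
        (mul_ne_zero hc' (Complex.ofReal_ne_zero.2 hsin'.ne')) (fun b => by
          by_cases hb : b = k
          · rw [hb, (ent_csem_gen hd.mem_gen hk _).2, (ent_csem_gen hd'.mem_gen hk _).2,
              if_neg (by omega), mul_zero, mul_zero]
          · have := h b
            rw [ent_csem_cell hk' hd.mem_gen, ent_csem_cell hk' hd'.mem_gen, if_neg hb,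
              if_neg hb] at this
            refine mul_left_cancel₀ Complex.I_ne_zero ?_
            linear_combination this) (fun b hb => by rw [csem_one, ent_one, if_neg (by tauto)])
      have := h k
      rw [ent_csem_cell hk' hd.mem_gen, ent_csem_cell hk' hd'.mem_gen, if_pos rfl,
        if_pos rfl] at this
      obtain ⟨rfl, rfl, rfl⟩ := euler_angles_unique hc hα hβ h0 hα' hβ' h0' hs this
      exact ⟨rfl, rfl⟩

theorem IsNF.mem_gen {x : Circuit n} (h : IsNF n k x) : x ∈ Gen n k := by
  induction h with
  | nil => exact one_mem _
  | cons hk hd _ _ ih =>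
    exact mul_mem hd.mem_gen (mul_mem (Ps_mem_gen le_rfl hk _) (gen_mono (Nat.le_succ _) ih))

theorem ent_csem_cons {d x : Circuit n} {γ : ℝ} (hk : k < n) (hx : x ∈ Gen n (k + 1)) (b : ℕ) :
    ent (csem (d * (Ps n k γ * x))) k b = Complex.exp (γ * Complex.I) * ent (csem d) k b := by
  rw [csem_mul, csem_mul, Matrix.mul_assoc, ent_mul_of_row hk (fun j hj => by
    rw [(ent_csem_gen hx hk j).1, if_neg hj]), ent_mul_of_row (k := k) hk (fun j hj => by
    rw [ent_csem_Ps hk, if_neg (by omega)]), (ent_csem_gen hx hk k).1, ent_csem_Ps hk]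
  simp [hk]

/-- A normal form is determined by its matrix. -/
theorem IsNF.eq_of_csem_eq {x y : Circuit n} (hx : IsNF n k x) (hy : IsNF n k y)
    (h : csem x = csem y) : x = y := by
  induction hx generalizing y with
  | nil =>
    cases hy with
    | nil => rfl
    | cons hk => omega
  | @cons k d x γ hk hd hγ hx ih =>
    cases hy with
    | nil => omega
    | @cons _ d' y γ' _ hd' hγ' hy =>
      obtain ⟨rfl, he⟩ := hd.eq_of_row hd' hk (Complex.exp_ne_zero (γ * Complex.I))
        (Complex.exp_ne_zero (γ' * Complex.I)) (fun b => by
          rw [← ent_csem_cons hk hx.mem_gen, h, ent_csem_cons hk hy.mem_gen])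
      obtain rfl := exp_mul_I_injOn hγ hγ' he
      rw [ih hy]
      -- The common run and phase have a unitary matrix, which is cancelled to compare the remaining
      -- normal forms.
      rw [← mul_assoc, ← mul_assoc, csem_mul, csem_mul _ y] at h
      have := congrArg (· * (csem (d * Ps n k γ))ᴴ) h
      simpa only [Matrix.mul_assoc, csem_mul_conjTranspose, Matrix.mul_one] using this

end Circuit

/-! ### Confluence -/

theorem Step.mono {Θ Φ Θ' Φ' : Set ℝ} (hΘ : Θ ⊆ Θ') (hΦ : Φ ⊆ Φ') {n : ℕ} {a b : Circuit n}
    (h : Step Θ Φ a b) : Step Θ' Φ' a b := by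
  induction h with
  | rule h =>
    refine .rule ?_
    cases h with
    | ps_mod ψ h => exact .ps_mod ψ h
    | bs_mod ψ h => exact .bs_mod ψ h
    | ps_fusion φ ψ h h' => exact .ps_fusion φ ψ h h'
    | ps_zero => exact .ps_zero
    | bs_zero => exact .bs_zero
    | bottom_phase φ θ h h' => exact .bottom_phase φ θ h h'
    | pi_div_two φ h => exact .pi_div_two φ h
    | top_phase φ θ h h' h'' => exact .top_phase φ θ h h' h''
    | bs_sub_pi θ h => exact .bs_sub_pi θ h
    | euler3 _ _ _ _ _ _ _ _ _ _ _ _ _ _ h₁ h₂ h₃ h h' hc hs =>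
      exact .euler3 _ _ _ _ _ _ _ _ _ _ _ _ _ _ (hΘ h₁) (hΘ h₂) (hΘ h₃)
        (fun φ hφ => hΦ (h φ hφ)) (fun φ hφ => hΦ (h' φ hφ)) hc hs
    | euler2 _ _ _ _ _ _ _ h₁ h₂ h hc hs =>
      exact .euler2 _ _ _ _ _ _ _ (hΘ h₁) (hΘ h₂) (fun φ hφ => hΦ (h φ hφ)) hc hs
  | comp_left D _ ih => exact .comp_left D ih
  | comp_right C _ ih => exact .comp_right C ih
  | tensor_left D _ ih => exact .tensor_left D ih
  | tensor_right C _ ih => exact .tensor_right C ih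

/-- Every rewriting system which contains PPRS is confluent, as every circuit reduces to a normal
form which depends only on its matrix. -/
theorem globallyConfluent_step {Θ Φ : Set ℝ} (hΘ : Set.Ioo 0 Real.pi ⊆ Θ)
    (hΦ : Set.Ioo 0 (2 * Real.pi) ⊆ Φ) (n : ℕ) :
    GloballyConfluent (Step Θ Φ (n := n)) := by
  intro a b c hb hc
  obtain ⟨x, hx, hbx⟩ := exists_isNF b
  obtain ⟨y, hy, hcy⟩ := exists_isNF c
  have hsem : csem x = csem y :=
    -- The given rewritings may use the larger system, whereas those to normal form stay in PPRS;
    -- both kinds preserve the matrix.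
    (csem_eq_of_reflTransGen hbx).symm.trans <| (csem_eq_of_reflTransGen hb).symm.trans <|
      (csem_eq_of_reflTransGen hc).trans (csem_eq_of_reflTransGen hcy)
  obtain rfl := hx.eq_of_csem_eq hy hsem
  exact ⟨x, hbx.lift id fun _ _ s => Step.mono hΘ hΦ s, hcy.lift id fun _ _ s => Step.mono hΘ hΦ s⟩

end LOpp

theorem mainTheorem3 (n : ℕ) :
    LOpp.GloballyConfluent (LOpp.PPRS n) ∧ LOpp.GloballyConfluent (LOpp.PPRSAnyAngle n) :=
  ⟨LOpp.globallyConfluent_step subset_rfl subset_rfl n,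
    LOpp.globallyConfluent_step (Set.subset_univ _) (Set.subset_univ _) n⟩
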